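/- Machine model. A randomized random access machine runs a fixed finite program (independent of the input and of its size) with finitely many registers and an initially zero memory indexed by natural numbers. Its primitive instructions are: load a constant, $+$, truncated $-$, $\times$, integer division, read/write memory, draw a fresh uniformly random element of $\{0,\dots,y-1\}$, and, for the input graph $G$, read $\deg(v)$, the $i$-th entry of the adjacency list of $v$, or an entry of the adjacency matrix; control flow consists of sequencing, branching and while loops on "register $\neq 0$". Cost is logarithmic: each instruction and test costs one plus the total number of binary digits of the numbers (including addresses) it handles. A query program is a program that makes no random draws, does not write to memory, and accesses $G$ only through its adjacency matrix. A memory content $M$ together with a query program is an adjacency oracle for a graph $H$ on $\{0,\dots,n-1\}$ with query time $T$ if for all nodes $u,v$ the query program, started with memory $M$ on input $(u,v)$, halts within cost $T$ and outputs $1$ if $(u,v)\in E(H)$ and $0$ otherwise. An edge-subgraph $H$ of $G$ is a $(2k-1)$-spanner if $\mathrm{dist}_H(s,t)\le(2k-1)\,\mathrm{dist}_G(s,t)$ for all nodes $s,t$. Write $\Lambda_C(n)=C(1+\log n)^C$. Theorem. For every $c\in\mathbb N$ there are a preprocessing program and a query program such that for every $A\in\mathbb N$ there is $C\in\mathbb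 N$ with the following property. Let $n\ge 1$, let $G$ be an unweighted undirected simple graph with $n$ nodes and $m$ edges, given by its adjacency matrix and by adjacency lists in arbitrary order, let $k\ge1$ be an integer with $k\le\Lambda_A(n)$, and let $\rho\ge1$ be a real number. Run the preprocessing program on $G$ with inputs $n$, $k$ and $\min(\lfloor\rho\rfloor,n)$. Then: 1. for every outcome of the random draws it halts within cost $\Lambda_C(n)\,(n+m/\rho)$, i.e. in $\widetilde O(n+m/\rho)$ time; 2. with probability at least $1-n^{-c}$, its final memory together with the query program is an adjacency oracle, with query time at most $\Lambda_C(n)=\widetilde O(1)$, for a $(2k-1)$-spanner $H\subseteq G$ with $|E(H)|\le\Lambda_C(n)\,n^{1+1/k}\rho^2$, i.e. with $\widetilde O(n^{1+1/k}\rho^2)$ edges. -/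

import Mathlib

open MeasureTheory

/-! ### Graphs, spanners and polylogarithmic factors -/

/-- An edge-subgraph `H` of `G` with `dist_H (s, t) ≤ κ * dist_G (s, t)` for all nodes `s, t`;
distances are extended (infinite between different components). -/
def IsSpanner {V : Type*} (G H : SimpleGraph V) (κ : ℕ) : Prop :=
  H ≤ G ∧ ∀ s t : V, H.edist s t ≤ (κ : ℕ∞) * G.edist s t

/-- The factor `C * (1 + log n) ^ C` hidden by the soft-O notation. -/
noncomputable def polylog (C n : ℕ) : ℝ :=
  (C : ℝ) * (1 + Real.log n) ^ C

/-- An adjacency list representation of `G`: for every node, the list of its neighbours, each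
occurring once, in an arbitrary order. -/
structure AdjList {n : ℕ} (G : SimpleGraph (Fin n)) where
  nbrs : Fin n → List (Fin n)
  nodup : ∀ v, (nbrs v).Nodup
  mem_iff : ∀ v w, w ∈ nbrs v ↔ G.Adj v w

namespace RAM

/-! ### A random access machine with logarithmic cost -/

/-- The access of a machine to a graph whose nodes are numbers. -/
structure GraphAccess where
  /-- entries of the adjacency matrix -/
  adj : ℕ → ℕ → ℕ
  /-- lengths of the adjacency lists -/
  deg : ℕ → ℕ
  /-- `nbr v i` is entry number `i` (from `0`) of the adjacency list of `v` -/
  nbr : ℕ → ℕ → ℕ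

open Classical in
/-- Access to `G` as an adjacency matrix and as an adjacency list; out-of-range requests are
answered by `0`. -/
noncomputable def GraphAccess.ofGraph {n : ℕ} (G : SimpleGraph (Fin n)) (L : AdjList G) :
    GraphAccess where
  adj u v := if h : u < n ∧ v < n then (if G.Adj ⟨u, h.1⟩ ⟨v, h.2⟩ then 1 else 0) else 0
  deg v := if h : v < n then (L.nbrs ⟨v, h⟩).length else 0
  nbr v i := if h : v < n then (((L.nbrs ⟨v, h⟩)[i]?).map Fin.val).getD 0 else 0

/-- Arithmetic on natural numbers: `sub` is truncated, `div` is the integer quotient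
(`0` for the divisor `0`). -/
inductive Op
  | add | sub | mul | div

def Op.eval : Op → ℕ → ℕ → ℕ
  | .add, a, b => a + b
  | .sub, a, b => a - b
  | .mul, a, b => a * b
  | .div, a, b => a / b

/-- Primitive instructions. The arguments named `x y z` are register numbers. -/
inductive Instr
  /-- `x := a` -/
  | const (x a : ℕ)
  /-- `x := y o z` -/
  | op (o : Op) (x y z : ℕ)
  /-- `x := memory[y]` -/
  | load (x y : ℕ)
  /-- `memory[x] := y` -/
  | store (x y : ℕ)
  /-- `x :=` a fresh uniformly random element of `{0, …, y - 1}` (`0` if `y = 0`) -/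
  | rand (x y : ℕ)
  /-- `x :=` the degree of node `y` -/
  | deg (x y : ℕ)
  /-- `x :=` entry number `z` of the adjacency list of node `y` -/
  | nbr (x y z : ℕ)
  /-- `x :=` the entry `(y, z)` of the adjacency matrix -/
  | adj (x y z : ℕ)

/-- Programs: finite pieces of syntax. Conditions test whether register `x` is nonzero. -/
inductive Prog
  | instr (i : Instr)
  | seq (p q : Prog)
  | ite (x : ℕ) (p q : Prog)
  | while (x : ℕ) (p : Prog)

/-- A state of the machine: registers, memory, and the number of random draws made so far. -/
structure State where
  reg : ℕ → ℕ
  mem : ℕ → ℕ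
  draws : ℕ

def State.set (σ : State) (x a : ℕ) : State :=
  { σ with reg := Function.update σ.reg x a }

/-- Sample points: for every index `t` and every `b`, an element of `{0, …, b}`. It is the outcome
of draw number `t` if that draw is from a range of `b + 1` numbers. -/
abbrev Tape : Type := (p : ℕ × ℕ) → Fin (p.2 + 1)

/-- All random numbers are independent and uniform. -/
noncomputable def tapeMeasure : Measure Tape :=
  Measure.infinitePi fun p : ℕ × ℕ => (PMF.uniformOfFintype (Fin (p.2 + 1))).toMeasure

instance : IsProbabilityMeasure tapeMeasure := by
  unfold tapeMeasure; infer_instance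

/-- Draw number `t`, from `{0, …, b - 1}`. -/
def Tape.draw (ω : Tape) (t b : ℕ) : ℕ :=
  if b = 0 then 0 else (ω (t, b - 1) : ℕ)

/-- The effect of a primitive instruction. -/
def Instr.run (g : GraphAccess) (ω : Tape) : Instr → State → State
  | .const x a, σ => σ.set x a
  | .op o x y z, σ => σ.set x (o.eval (σ.reg y) (σ.reg z))
  | .load x y, σ => σ.set x (σ.mem (σ.reg y))
  | .store x y, σ => { σ with mem := Function.update σ.mem (σ.reg x) (σ.reg y) }
  | .rand x y, σ => { σ.set x (ω.draw σ.draws (σ.reg y)) with draws := σ.draws + 1 }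
  | .deg x y, σ => σ.set x (g.deg (σ.reg y))
  | .nbr x y z, σ => σ.set x (g.nbr (σ.reg y) (σ.reg z))
  | .adj x y z, σ => σ.set x (g.adj (σ.reg y) (σ.reg z))

/-- Logarithmic cost: one plus the total number of binary digits of the numbers (including
memory addresses) that the instruction handles. -/
def Instr.cost (g : GraphAccess) : Instr → State → ℕ
  | .const _ a, _ => 1 + a.size
  | .op _ _ y z, σ => 1 + (σ.reg y).size + (σ.reg z).size
  | .load _ y, σ => 1 + (σ.reg y).size + (σ.mem (σ.reg y)).size
  | .store x y, σ => 1 + (σ.reg x).size + (σ.reg y).size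
  | .rand _ y, σ => 1 + (σ.reg y).size
  | .deg _ y, σ => 1 + (σ.reg y).size + (g.deg (σ.reg y)).size
  | .nbr _ y z, σ => 1 + (σ.reg y).size + (σ.reg z).size + (g.nbr (σ.reg y) (σ.reg z)).size
  | .adj _ y z, σ => 1 + (σ.reg y).size + (σ.reg z).size

/-- `Exec g ω p σ t τ`: program `p`, started in state `σ`, halts in state `τ` after total cost
`t`. -/
inductive Exec (g : GraphAccess) (ω : Tape) : Prog → State → ℕ → State → Prop
  | instr (i : Instr) (σ : State) :
      Exec g ω (.instr i) σ (i.cost g σ) (i.run g ω σ)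
  | seq {p q : Prog} {σ τ υ : State} {s t : ℕ} :
      Exec g ω p σ s τ → Exec g ω q τ t υ → Exec g ω (.seq p q) σ (s + t) υ
  | ite_true {x : ℕ} {p q : Prog} {σ τ : State} {t : ℕ} :
      σ.reg x ≠ 0 → Exec g ω p σ t τ →
        Exec g ω (.ite x p q) σ (1 + (σ.reg x).size + t) τ
  | ite_false {x : ℕ} {p q : Prog} {σ τ : State} {t : ℕ} :
      σ.reg x = 0 → Exec g ω q σ t τ →
        Exec g ω (.ite x p q) σ (1 + (σ.reg x).size + t) τ
  | while_false {x : ℕ} {p : Prog} {σ : State} :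
      σ.reg x = 0 → Exec g ω (.while x p) σ (1 + (σ.reg x).size) σ
  | while_true {x : ℕ} {p : Prog} {σ τ υ : State} {s t : ℕ} :
      σ.reg x ≠ 0 → Exec g ω p σ s τ → Exec g ω (.while x p) τ t υ →
        Exec g ω (.while x p) σ (1 + (σ.reg x).size + s + t) υ

/-- Once the random numbers are fixed, a run is deterministic. -/
theorem Exec.unique {g : GraphAccess} {ω : Tape} {p : Prog} {σ τ : State} {t : ℕ}
    (h : Exec g ω p σ t τ) :
    ∀ {t' : ℕ} {τ' : State}, Exec g ω p σ t' τ' → t = t' ∧ τ = τ' := by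
  induction h with
  | instr i σ => intro t' τ' h'; cases h'; exact ⟨rfl, rfl⟩
  | seq _ _ ih₁ ih₂ =>
    intro t' τ' h'
    cases h' with
    | seq h₁ h₂ =>
      obtain ⟨rfl, rfl⟩ := ih₁ h₁
      obtain ⟨rfl, rfl⟩ := ih₂ h₂
      exact ⟨rfl, rfl⟩
  | ite_true hx _ ih =>
    intro t' τ' h'
    cases h' with
    | ite_true _ h₁ => obtain ⟨rfl, rfl⟩ := ih h₁; exact ⟨rfl, rfl⟩
    | ite_false hx' _ => exact absurd hx' hx
  | ite_false hx _ ih =>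
    intro t' τ' h'
    cases h' with
    | ite_true hx' _ => exact absurd hx hx'
    | ite_false _ h₁ => obtain ⟨rfl, rfl⟩ := ih h₁; exact ⟨rfl, rfl⟩
  | while_false hx =>
    intro t' τ' h'
    cases h' with
    | while_false _ => exact ⟨rfl, rfl⟩
    | while_true hx' _ _ => exact absurd hx hx'
  | while_true hx _ _ ih₁ ih₂ =>
    intro t' τ' h'
    cases h' with
    | while_false hx' => exact absurd hx' hx
    | while_true _ h₁ h₂ =>
      obtain ⟨rfl, rfl⟩ := ih₁ h₁
      obtain ⟨rfl, rfl⟩ := ih₂ h₂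
      exact ⟨rfl, rfl⟩

/-- Instructions allowed in a query program: no randomness, no writing to memory, and no access
to the input graph except through its adjacency matrix. -/
def Instr.IsQuery : Instr → Prop
  | .const _ _ | .op _ _ _ _ | .load _ _ | .adj _ _ _ => True
  | .store _ _ | .rand _ _ | .deg _ _ | .nbr _ _ _ => False

def Prog.IsQuery : Prog → Prop
  | .instr i => i.IsQuery
  | .seq p q => p.IsQuery ∧ q.IsQuery
  | .ite _ p q => p.IsQuery ∧ q.IsQuery
  | .while _ p => p.IsQuery

/-- The state with memory `M`, registers `0, 1, …` holding the inputs, and all other registers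
holding `0`. -/
def State.start (inputs : List ℕ) (M : ℕ → ℕ) : State where
  reg x := inputs.getD x 0
  mem := M
  draws := 0

open Classical in
/-- The data structure `M`, together with the query program `query`, is an adjacency oracle for
`H` with query time at most `T`: on every query `(u, v)`, the program halts after cost at most `T`
with the bit that says whether `(u, v)` is an edge of `H` in register `0`. (A query program makes
no random draws, so it does not matter which tape it is run with.) -/
def IsAdjacencyOracle {n : ℕ} (g : GraphAccess) (query : Prog) (M : ℕ → ℕ)
    (H : SimpleGraph (Fin n)) (T : ℝ) : Prop :=
  query.IsQuery ∧ ∀ (u v : Fin n) (ω : Tape), ∃ (t : ℕ) (τ : State),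
    Exec g ω query (State.start [(u : ℕ), (v : ℕ)] M) t τ ∧ (t : ℝ) ≤ T ∧
      τ.reg 0 = if H.Adj u v then 1 else 0

end RAM

namespace RAM

/-! ### Sizes of numbers and addresses -/

/-! Put r = min(⌊ρ⌋, n) and draw ⌈deg v / r⌉ samples, with replacement, from the adjacency list of
every node v; these are O(n + m/ρ) samples. Balls are grown along sampled arcs only. Let q be the
least integer with n ≤ q^k. From an unlabelled centre, a breadth-first search through unlabelled
nodes goes on as long as the next layer makes the ball more than q times as large as the part
already scanned. The scanned nodes receive the label of the centre and form its cluster; the last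
layer belongs to the ball but stays unlabelled. Since the ball never exceeds n ≤ q^k nodes, for some
i < k the cluster has radius at most i and the ball at most i + 1, and all balls together have at
most q n entries. `Grown` and `Growing` are the invariants.

The spanner keeps the tree edges and every edge neither of whose ends lies in the ball belonging to
the label of the other. An omitted edge is bridged inside one ball by i + (i + 1) ≤ 2k - 1 tree
edges, for every outcome of the draws (`Grown.isSpanner`). Kept edges are never listed: a query
combines one matrix entry with a few table entries, so the preprocessing need not read all of G.

Randomness matters only for the number of edges. A kept edge outside the trees, oriented towards the
larger label, is hit by no sample (`Grown.sample_ne`). A fixed set U of adjacent pairs escapes all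
samples with probability at most exp(-|U|/r) (`avoids_le`). The set in question depends on the
samples, but it is determined by the labels and the ball entries, which leaves at most (n+1)^(3N)
possibilities when N ≥ n bounds the number of entries. A union bound (`badEvent_le`) makes sets of
r(3N + c) log(n+1) or more pairs unlikely.

For the machine, the algorithm is written in a small while language and compiled. Compiled code
costs at most a constant times the number of steps times the bit length of the largest number
assigned (`Stmt.code_spec`); steps are counted with potentials (`Stmt.Run.loop`). -/

theorem size_add_le (a b : ℕ) : (a + b).size ≤ a.size + b.size + 1 := by
  rw [Nat.size_le]
  have h₁ := Nat.lt_size_self a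
  have h₂ := Nat.lt_size_self b
  have h₃ : 2 ^ a.size ≤ 2 ^ (a.size + b.size) := Nat.pow_le_pow_right (by norm_num) (by omega)
  have h₄ : 2 ^ b.size ≤ 2 ^ (a.size + b.size) := Nat.pow_le_pow_right (by norm_num) (by omega)
  rw [pow_succ]
  omega

theorem size_mul_le (a b : ℕ) : (a * b).size ≤ a.size + b.size := by
  rw [Nat.size_le, pow_add]
  exact Nat.mul_lt_mul'' (Nat.lt_size_self a) (Nat.lt_size_self b)

/-- An injective pairing that a machine can compute with three instructions. -/
def pair (a b : ℕ) : ℕ := (a + b) * (a + b) + b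

/-- The value lies between (a + b)² and (a + b + 1)², so it determines a + b, and then b. -/
theorem pair_inj {a b a' b' : ℕ} : pair a b = pair a' b' ↔ a = a' ∧ b = b' := by
  refine ⟨fun h => ?_, by rintro ⟨rfl, rfl⟩; rfl⟩
  unfold pair at h
  have hs : a + b = a' + b' := by
    rcases lt_trichotomy (a + b) (a' + b') with hlt | heq | hlt
    · nlinarith
    · exact heq
    · nlinarith
  rw [hs] at h
  omega

theorem size_pair_le (a b : ℕ) : (pair a b).size ≤ 3 * (a.size + b.size + 1) := by
  unfold pair
  have h₁ := size_add_le a b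
  have h₂ := size_mul_le (a + b) (a + b)
  have h₃ := size_add_le ((a + b) * (a + b)) b
  omega

/-- The address of the entry `(a, b)` of the array number `j`. -/
def cell (j a b : ℕ) : ℕ := pair (pair a b) j

theorem cell_inj {j a b j' a' b' : ℕ} :
    cell j a b = cell j' a' b' ↔ j = j' ∧ a = a' ∧ b = b' := by
  unfold cell
  rw [pair_inj, pair_inj]
  tauto

theorem size_eval_le (o : Op) (a b : ℕ) : (o.eval a b).size ≤ a.size + b.size + 1 := by
  cases o
  · exact size_add_le a b
  · have := Nat.size_le_size (Nat.sub_le a b)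
    simp only [Op.eval]; omega
  · have := size_mul_le a b
    simp only [Op.eval]; omega
  · have := Nat.size_le_size (Nat.div_le_self a b)
    simp only [Op.eval]; omega

/-! ### While programs with expressions and two-dimensional arrays -/

/-- States of while programs: sixteen variables, arrays, and the number of draws so far. -/
structure Env where
  reg : Fin 16 → ℕ
  arr : ℕ → ℕ → ℕ → ℕ
  draws : ℕ

def Env.set (ε : Env) (x : Fin 16) (a : ℕ) : Env :=
  { ε with reg := fun y => if y = x then a else ε.reg y }

def Env.put (ε : Env) (j a b v : ℕ) : Env :=
  { ε with arr := fun j' a' b' => if j' = j ∧ a' = a ∧ b' = b then v else ε.arr j' a' b' }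

def Env.drawn (ε : Env) : Env := { ε with draws := ε.draws + 1 }

@[simp] theorem Env.set_reg (ε : Env) (x y : Fin 16) (a : ℕ) :
    (ε.set x a).reg y = if y = x then a else ε.reg y := rfl
@[simp] theorem Env.set_arr (ε : Env) (x : Fin 16) (a : ℕ) : (ε.set x a).arr = ε.arr := rfl
@[simp] theorem Env.set_draws (ε : Env) (x : Fin 16) (a : ℕ) : (ε.set x a).draws = ε.draws := rfl
@[simp] theorem Env.put_reg (ε : Env) (j a b v : ℕ) : (ε.put j a b v).reg = ε.reg := rfl
@[simp] theorem Env.put_arr (ε : Env) (j a b v j' a' b' : ℕ) : (ε.put j a b v).arr j' a' b' =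
    if j' = j ∧ a' = a ∧ b' = b then v else ε.arr j' a' b' := rfl
@[simp] theorem Env.put_draws (ε : Env) (j a b v : ℕ) : (ε.put j a b v).draws = ε.draws := rfl
@[simp] theorem Env.drawn_reg (ε : Env) : ε.drawn.reg = ε.reg := rfl
@[simp] theorem Env.drawn_arr (ε : Env) : ε.drawn.arr = ε.arr := rfl
@[simp] theorem Env.drawn_draws (ε : Env) : ε.drawn.draws = ε.draws + 1 := rfl

inductive Ex
  | var (x : Fin 16)
  | cst (a : ℕ)
  | op (o : Op) (e f : Ex)
  | arr (j : ℕ) (e f : Ex)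
  | deg (e : Ex)
  | nbr (e f : Ex)
  | adj (e f : Ex)

def Ex.eval (g : GraphAccess) (ε : Env) : Ex → ℕ
  | .var x => ε.reg x
  | .cst a => a
  | .op o e f => o.eval (e.eval g ε) (f.eval g ε)
  | .arr j e f => ε.arr j (e.eval g ε) (f.eval g ε)
  | .deg e => g.deg (e.eval g ε)
  | .nbr e f => g.nbr (e.eval g ε) (f.eval g ε)
  | .adj e f => g.adj (e.eval g ε) (f.eval g ε)

inductive Stmt
  | skip
  | assign (x : Fin 16) (e : Ex)
  | store (j : ℕ) (e f v : Ex)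
  | rand (x : Fin 16) (e : Ex)
  | seq (p q : Stmt)
  | ite (e : Ex) (p q : Stmt)
  | loop (e : Ex) (p : Stmt)

/-! ### Compilation -/

def pairCode (d : ℕ) : Prog :=
  .seq (.instr (.op .add d d (d + 1)))
    (.seq (.instr (.op .mul d d d)) (.instr (.op .add d d (d + 1))))

def cellCode (j d : ℕ) : Prog :=
  .seq (pairCode d) (.seq (.instr (.const (d + 1) j)) (pairCode d))

/-- Code that evaluates an expression into register `d`, using the registers from `d` on. -/
def Ex.code : Ex → ℕ → Prog
  | .var x, d => .seq (.instr (.const d 0)) (.instr (.op .add d x d))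
  | .cst a, d => .instr (.const d a)
  | .op o e f, d => .seq (e.code d) (.seq (f.code (d + 1)) (.instr (.op o d d (d + 1))))
  | .arr j e f, d =>
    .seq (e.code d) (.seq (f.code (d + 1)) (.seq (cellCode j d) (.instr (.load d d))))
  | .deg e, d => .seq (e.code d) (.instr (.deg d d))
  | .nbr e f, d => .seq (e.code d) (.seq (f.code (d + 1)) (.instr (.nbr d d (d + 1))))
  | .adj e f, d => .seq (e.code d) (.seq (f.code (d + 1)) (.instr (.adj d d (d + 1))))

def Stmt.code : Stmt → Prog
  | .skip => .instr (.const 16 0)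
  | .assign x e => .seq (e.code 16) (.seq (.instr (.const 17 0)) (.instr (.op .add x 16 17)))
  | .store j e f v =>
    .seq (v.code 16) (.seq (e.code 17) (.seq (f.code 18)
      (.seq (cellCode j 17) (.instr (.store 17 16)))))
  | .rand x e => .seq (e.code 16) (.instr (.rand x 16))
  | .seq p q => .seq p.code q.code
  | .ite e p q => .seq (e.code 16) (.ite 16 p.code q.code)
  | .loop e p => .seq (e.code 16) (.while 16 (.seq p.code (e.code 16)))

/-- A machine state that represents the state of a while program. -/
structure Rep (ε : Env) (σ : State) : Prop where
  reg : ∀ x : Fin 16, σ.reg x = ε.reg x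
  mem : ∀ j a b, σ.mem (cell j a b) = ε.arr j a b
  draws : σ.draws = ε.draws

structure GraphAccess.Bdd (g : GraphAccess) (M : ℕ) : Prop where
  deg : ∀ v, g.deg v ≤ M
  nbr : ∀ v i, g.nbr v i ≤ M
  adj : ∀ u v, g.adj u v ≤ M

structure Env.Bdd (ε : Env) (M : ℕ) : Prop where
  reg : ∀ x, ε.reg x ≤ M
  arr : ∀ j a b, ε.arr j a b ≤ M

/-- `τ` differs from `σ` at most in the registers from `d` on. -/
structure SameBelow (d : ℕ) (σ τ : State) : Prop where
  reg : ∀ x < d, τ.reg x = σ.reg x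
  mem : τ.mem = σ.mem
  draws : τ.draws = σ.draws

theorem SameBelow.trans {d d' : ℕ} {σ τ υ : State} (h : SameBelow d σ τ) (h' : SameBelow d' τ υ)
    (hd : d ≤ d') : SameBelow d σ υ :=
  ⟨fun x hx => (h'.reg x (by omega)).trans (h.reg x hx), h'.mem.trans h.mem,
    h'.draws.trans h.draws⟩

theorem SameBelow.rep {d : ℕ} {σ τ : State} {ε : Env} (h : SameBelow d σ τ) (hd : 16 ≤ d)
    (hε : Rep ε σ) : Rep ε τ :=
  ⟨fun x => (h.reg x (by omega)).trans (hε.reg x), fun j a b => by rw [h.mem, hε.mem],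
    h.draws.trans hε.draws⟩

theorem SameBelow.set (d a : ℕ) (σ : State) : SameBelow d σ (σ.set d a) :=
  ⟨fun x hx => by simp [State.set, Function.update_of_ne (Nat.ne_of_lt hx)], rfl, rfl⟩

@[simp] theorem State.set_reg (σ : State) (x y a : ℕ) :
    (σ.set x a).reg y = if y = x then a else σ.reg y := by
  simp [State.set, Function.update_apply]
@[simp] theorem State.set_mem (σ : State) (x a : ℕ) : (σ.set x a).mem = σ.mem := rfl
@[simp] theorem State.set_draws (σ : State) (x a : ℕ) : (σ.set x a).draws = σ.draws := rfl

theorem pairCode_spec (g : GraphAccess) (ω : Tape) (d : ℕ) (σ : State) :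
    ∃ t τ, Exec g ω (pairCode d) σ t τ ∧ t ≤ 10 * ((σ.reg d).size + (σ.reg (d + 1)).size + 1) ∧
      τ.reg d = pair (σ.reg d) (σ.reg (d + 1)) ∧ τ.reg (d + 1) = σ.reg (d + 1) ∧
      SameBelow d σ τ := by
  refine ⟨_, _, .seq (.instr _ _) (.seq (.instr _ _) (.instr _ _)), ?_, ?_, ?_, ?_, rfl, rfl⟩
  · have h₁ := size_add_le (σ.reg d) (σ.reg (d + 1))
    have h₂ := size_mul_le (σ.reg d + σ.reg (d + 1)) (σ.reg d + σ.reg (d + 1))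
    simp [Instr.cost, Instr.run, Op.eval]
    omega
  · simp [Instr.run, Op.eval, pair]
  · simp [Instr.run]
  · intro x hx
    simp [Instr.run, hx.ne]

theorem cellCode_spec (g : GraphAccess) (ω : Tape) (j d : ℕ) (σ : State) :
    ∃ t τ, Exec g ω (cellCode j d) σ t τ ∧
      t ≤ 60 * ((σ.reg d).size + (σ.reg (d + 1)).size + j.size + 1) ∧
      τ.reg d = cell j (σ.reg d) (σ.reg (d + 1)) ∧ SameBelow d σ τ := by
  obtain ⟨t₁, τ₁, e₁, c₁, r₁, -, s₁⟩ := pairCode_spec g ω d σ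
  obtain ⟨t₂, τ₂, e₂, c₂, r₂, -, s₂⟩ := pairCode_spec g ω d (τ₁.set (d + 1) j)
  refine ⟨_, _, .seq e₁ (.seq (.instr _ _) e₂), ?_, ?_, ?_⟩
  · have h := size_pair_le (σ.reg d) (σ.reg (d + 1))
    simp [r₁] at c₂
    simp [Instr.cost]
    omega
  · simpa [r₁, cell] using r₂
  · refine s₁.trans ⟨fun x hx => ?_, s₂.mem, s₂.draws⟩ le_rfl
    rw [s₂.reg x hx]
    simp
    omega

/-- The code of an expression computes its value; the cost is proportional to the number of bits
of the numbers present. -/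
theorem Ex.code_spec (e : Ex) : ∃ K : ℕ, ∀ (g : GraphAccess) (ω : Tape) (M d : ℕ) (ε : Env)
    (σ : State), 1 ≤ M → g.Bdd M → ε.Bdd M → 16 ≤ d → Rep ε σ → ∃ t τ,
      Exec g ω (e.code d) σ t τ ∧ t ≤ K * M.size ∧ τ.reg d = e.eval g ε ∧
      (e.eval g ε).size ≤ K * M.size ∧ SameBelow d σ τ := by
  have pos : ∀ {M : ℕ}, 1 ≤ M → 1 ≤ M.size := fun h => Nat.size_pos.2 h
  induction e with
  | var x =>
    refine ⟨3, fun g ω M d ε σ hM hg hε hd hr =>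
      ⟨_, _, .seq (.instr _ _) (.instr _ _), ?_, ?_, ?_, ?_, rfl, rfl⟩⟩
    · have := pos hM
      have h := Nat.size_le_size (hε.reg x)
      -- Variables live in registers below 16 and scratch space starts at `d ≥ 16`, so clearing `d`
      -- before the addition does not destroy the variable.
      have hx : (x : ℕ) ≠ d := by omega
      simp [Instr.cost, Instr.run, hx, hr.reg x]
      omega
    · have hx : (x : ℕ) ≠ d := by omega
      simp [Instr.run, Op.eval, hx, hr.reg x, Ex.eval]
    · have h := Nat.size_le_size (hε.reg x)
      simp only [Ex.eval]
      omega
    · intro y hy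
      simp [Instr.run, hy.ne]
  | cst a =>
    refine ⟨1 + a.size, fun g ω M d ε σ hM hg hε hd hr =>
      ⟨_, _, .instr _ _, ?_, ?_, ?_, .set _ _ _⟩⟩
    · have := pos hM
      simp only [Instr.cost]
      nlinarith
    · simp [Instr.run, Ex.eval]
    · have := pos hM
      simp only [Ex.eval]
      nlinarith
  | op o e f ihe ihf =>
    obtain ⟨K, hK⟩ := ihe
    obtain ⟨K', hK'⟩ := ihf
    refine ⟨2 * K + 2 * K' + 1, fun g ω M d ε σ hM hg hε hd hr => ?_⟩
    obtain ⟨t₁, τ₁, e₁, c₁, r₁, b₁, s₁⟩ := hK g ω M d ε σ hM hg hε hd hr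
    obtain ⟨t₂, τ₂, e₂, c₂, r₂, b₂, s₂⟩ :=
      hK' g ω M (d + 1) ε τ₁ hM hg hε (by omega) (s₁.rep hd hr)
    have hrd : τ₂.reg d = e.eval g ε := by rw [s₂.reg d (by omega), r₁]
    have := pos hM
    refine ⟨_, _, .seq e₁ (.seq e₂ (.instr _ _)), ?_, ?_, ?_,
      (s₁.trans s₂ (by omega)).trans (.set _ _ _) le_rfl⟩
    · simp only [Instr.cost, hrd, r₂]
      nlinarith
    · simp [Instr.run, hrd, r₂, Ex.eval]
    · have := size_eval_le o (e.eval g ε) (f.eval g ε)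
      simp only [Ex.eval]
      nlinarith
  | arr j e f ihe ihf =>
    obtain ⟨K, hK⟩ := ihe
    obtain ⟨K', hK'⟩ := ihf
    refine ⟨200 * (K + K' + j.size + 1), fun g ω M d ε σ hM hg hε hd hr => ?_⟩
    obtain ⟨t₁, τ₁, e₁, c₁, r₁, b₁, s₁⟩ := hK g ω M d ε σ hM hg hε hd hr
    obtain ⟨t₂, τ₂, e₂, c₂, r₂, b₂, s₂⟩ :=
      hK' g ω M (d + 1) ε τ₁ hM hg hε (by omega) (s₁.rep hd hr)
    have hrd : τ₂.reg d = e.eval g ε := by rw [s₂.reg d (by omega), r₁]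
    obtain ⟨t₃, τ₃, e₃, c₃, r₃, s₃⟩ := cellCode_spec g ω j d τ₂
    rw [hrd, r₂] at c₃ r₃
    have hr₃ := ((s₁.trans s₂ (by omega)).trans s₃ le_rfl).rep hd hr
    have := pos hM
    have hv := Nat.size_le_size (hε.arr j (e.eval g ε) (f.eval g ε))
    have hc := size_pair_le (pair (e.eval g ε) (f.eval g ε)) j
    have hc' := size_pair_le (e.eval g ε) (f.eval g ε)
    have hj : j.size ≤ j.size * M.size := Nat.le_mul_of_pos_right _ this
    refine ⟨_, _, .seq e₁ (.seq e₂ (.seq e₃ (.instr _ _))), ?_, ?_, ?_,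
      ((s₁.trans s₂ (by omega)).trans s₃ le_rfl).trans (.set _ _ _) le_rfl⟩
    · simp only [Instr.cost, r₃, hr₃.mem]
      rw [cell]
      simp only [Nat.mul_add, Nat.add_mul, Nat.mul_assoc]
      omega
    · simp [Instr.run, r₃, hr₃.mem, Ex.eval]
    · simp only [Ex.eval]
      nlinarith
  | deg e ihe =>
    obtain ⟨K, hK⟩ := ihe
    refine ⟨2 * K + 2, fun g ω M d ε σ hM hg hε hd hr => ?_⟩
    obtain ⟨t₁, τ₁, e₁, c₁, r₁, b₁, s₁⟩ := hK g ω M d ε σ hM hg hε hd hr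
    have := pos hM
    have hv := Nat.size_le_size (hg.deg (e.eval g ε))
    refine ⟨_, _, .seq e₁ (.instr _ _), ?_, ?_, ?_, s₁.trans (.set _ _ _) le_rfl⟩
    · simp only [Instr.cost, r₁]
      nlinarith
    · simp [Instr.run, r₁, Ex.eval]
    · simp only [Ex.eval]
      nlinarith
  | nbr e f ihe ihf =>
    obtain ⟨K, hK⟩ := ihe
    obtain ⟨K', hK'⟩ := ihf
    refine ⟨2 * K + 2 * K' + 2, fun g ω M d ε σ hM hg hε hd hr => ?_⟩
    obtain ⟨t₁, τ₁, e₁, c₁, r₁, b₁, s₁⟩ := hK g ω M d ε σ hM hg hε hd hr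
    obtain ⟨t₂, τ₂, e₂, c₂, r₂, b₂, s₂⟩ :=
      hK' g ω M (d + 1) ε τ₁ hM hg hε (by omega) (s₁.rep hd hr)
    have hrd : τ₂.reg d = e.eval g ε := by rw [s₂.reg d (by omega), r₁]
    have := pos hM
    have hv := Nat.size_le_size (hg.nbr (e.eval g ε) (f.eval g ε))
    refine ⟨_, _, .seq e₁ (.seq e₂ (.instr _ _)), ?_, ?_, ?_,
      (s₁.trans s₂ (by omega)).trans (.set _ _ _) le_rfl⟩
    · simp only [Instr.cost, hrd, r₂]
      nlinarith
    · simp [Instr.run, hrd, r₂, Ex.eval]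
    · simp only [Ex.eval]
      nlinarith
  | adj e f ihe ihf =>
    obtain ⟨K, hK⟩ := ihe
    obtain ⟨K', hK'⟩ := ihf
    refine ⟨2 * K + 2 * K' + 2, fun g ω M d ε σ hM hg hε hd hr => ?_⟩
    obtain ⟨t₁, τ₁, e₁, c₁, r₁, b₁, s₁⟩ := hK g ω M d ε σ hM hg hε hd hr
    obtain ⟨t₂, τ₂, e₂, c₂, r₂, b₂, s₂⟩ :=
      hK' g ω M (d + 1) ε τ₁ hM hg hε (by omega) (s₁.rep hd hr)
    have hrd : τ₂.reg d = e.eval g ε := by rw [s₂.reg d (by omega), r₁]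
    have := pos hM
    have hv := Nat.size_le_size (hg.adj (e.eval g ε) (f.eval g ε))
    refine ⟨_, _, .seq e₁ (.seq e₂ (.instr _ _)), ?_, ?_, ?_,
      (s₁.trans s₂ (by omega)).trans (.set _ _ _) le_rfl⟩
    · simp only [Instr.cost, hrd, r₂]
      nlinarith
    · simp [Instr.run, hrd, r₂, Ex.eval]
    · simp only [Ex.eval]
      nlinarith

/-! ### Semantics of while programs -/

/-- `Stmt.Exec g ω M p ε N ε'`: started in `ε`, the program `p` halts in `ε'` after `N` steps, and
never assigns a number exceeding `M`. -/
inductive Stmt.Exec (g : GraphAccess) (ω : Tape) (M : ℕ) : Stmt → Env → ℕ → Env → Prop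
  | skip (ε : Env) : Stmt.Exec g ω M .skip ε 1 ε
  | assign (x : Fin 16) (e : Ex) (ε : Env) : e.eval g ε ≤ M →
      Stmt.Exec g ω M (.assign x e) ε 1 (ε.set x (e.eval g ε))
  | store (j : ℕ) (e f v : Ex) (ε : Env) : v.eval g ε ≤ M →
      Stmt.Exec g ω M (.store j e f v) ε 1 (ε.put j (e.eval g ε) (f.eval g ε) (v.eval g ε))
  | rand (x : Fin 16) (e : Ex) (ε : Env) : ω.draw ε.draws (e.eval g ε) ≤ M →
      Stmt.Exec g ω M (.rand x e) ε 1 (ε.set x (ω.draw ε.draws (e.eval g ε))).drawn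
  | seq {p q : Stmt} {ε ε' ε'' : Env} {N N' : ℕ} : Stmt.Exec g ω M p ε N ε' →
      Stmt.Exec g ω M q ε' N' ε'' → Stmt.Exec g ω M (.seq p q) ε (N + N') ε''
  | ite_true {e : Ex} {p q : Stmt} {ε ε' : Env} {N : ℕ} : e.eval g ε ≠ 0 →
      Stmt.Exec g ω M p ε N ε' → Stmt.Exec g ω M (.ite e p q) ε (N + 1) ε'
  | ite_false {e : Ex} {p q : Stmt} {ε ε' : Env} {N : ℕ} : e.eval g ε = 0 →
      Stmt.Exec g ω M q ε N ε' → Stmt.Exec g ω M (.ite e p q) ε (N + 1) ε'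
  | while_false {e : Ex} {p : Stmt} {ε : Env} : e.eval g ε = 0 →
      Stmt.Exec g ω M (.loop e p) ε 1 ε
  | while_true {e : Ex} {p : Stmt} {ε ε' ε'' : Env} {N N' : ℕ} : e.eval g ε ≠ 0 →
      Stmt.Exec g ω M p ε N ε' → Stmt.Exec g ω M (.loop e p) ε' N' ε'' →
      Stmt.Exec g ω M (.loop e p) ε (N + N' + 1) ε''

theorem Env.Bdd.set {ε : Env} {M a : ℕ} (h : ε.Bdd M) (x : Fin 16) (ha : a ≤ M) :
    (ε.set x a).Bdd M :=
  ⟨fun y => by rw [Env.set_reg]; split_ifs; exacts [ha, h.reg y], h.arr⟩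

theorem Env.Bdd.put {ε : Env} {M v : ℕ} (h : ε.Bdd M) (j a b : ℕ) (ha : v ≤ M) :
    (ε.put j a b v).Bdd M :=
  ⟨h.reg, fun j' a' b' => by rw [Env.put_arr]; split_ifs; exacts [ha, h.arr _ _ _]⟩

theorem Stmt.Exec.bdd {g : GraphAccess} {ω : Tape} {M : ℕ} {p : Stmt} {ε ε' : Env} {N : ℕ}
    (h : Stmt.Exec g ω M p ε N ε') (hε : ε.Bdd M) : ε'.Bdd M := by
  induction h with
  | skip | while_false _ => exact hε
  | assign x e ε h => exact hε.set x h
  | store j e f v ε h => exact hε.put j _ _ h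
  | rand x e ε h => exact ⟨(hε.set x h).reg, hε.arr⟩
  | seq _ _ ih ih' | while_true _ _ _ ih ih' => exact ih' (ih hε)
  | ite_true _ _ ih | ite_false _ _ ih => exact ih hε

theorem Rep.set {ε : Env} {σ : State} (h : Rep ε σ) (x : Fin 16) (a : ℕ) :
    Rep (ε.set x a) (σ.set x a) :=
  ⟨fun y => by simp [h.reg y, Fin.ext_iff], h.mem, h.draws⟩

/-- The compiled program does what the while program does; every step costs at most a constant
times the number of bits of the largest number. -/
theorem Stmt.code_spec (p : Stmt) : ∃ K : ℕ, ∀ (g : GraphAccess) (ω : Tape) (M : ℕ) (ε ε' : Env)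
    (N : ℕ) (σ : State), Stmt.Exec g ω M p ε N ε' → 1 ≤ M → g.Bdd M → ε.Bdd M → Rep ε σ →
      ∃ t τ, RAM.Exec g ω p.code σ t τ ∧ t ≤ K * N * M.size ∧ Rep ε' τ := by
  have pos : ∀ {M : ℕ}, 1 ≤ M → 1 ≤ M.size := fun h => Nat.size_pos.2 h
  induction p with
  | skip =>
    refine ⟨1, fun g ω M ε ε' N σ h hM hg hε hr => ?_⟩
    cases h
    refine ⟨_, _, .instr _ _, ?_, (SameBelow.set 16 0 σ).rep le_rfl hr⟩
    simpa [Instr.cost] using pos hM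
  | assign x e =>
    obtain ⟨K, hK⟩ := e.code_spec
    refine ⟨2 * K + 2, fun g ω M ε ε' N σ h hM hg hε hr => ?_⟩
    cases h
    obtain ⟨t₁, τ₁, e₁, c₁, r₁, b₁, s₁⟩ := hK g ω M 16 ε σ hM hg hε le_rfl hr
    have h₁ := s₁.rep le_rfl hr
    have h₂ := ((SameBelow.set 17 0 τ₁).rep (by norm_num) h₁).set x (e.eval g ε)
    refine ⟨_, _, .seq e₁ (.seq (.instr _ _) (.instr _ _)), ?_, ?_⟩
    · have := pos hM
      simp [Instr.cost, Instr.run, r₁]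
      nlinarith
    · simpa [Instr.run, Op.eval, r₁] using h₂
  | store j e f v =>
    obtain ⟨K₁, h₁⟩ := v.code_spec
    obtain ⟨K₂, h₂⟩ := e.code_spec
    obtain ⟨K₃, h₃⟩ := f.code_spec
    refine ⟨200 * (K₁ + K₂ + K₃ + j.size + 1), fun g ω M ε ε' N σ h hM hg hε hr => ?_⟩
    cases h
    obtain ⟨t₁, τ₁, e₁, c₁, r₁, b₁, s₁⟩ := h₁ g ω M 16 ε σ hM hg hε le_rfl hr
    have hr₁ := s₁.rep le_rfl hr
    obtain ⟨t₂, τ₂, e₂, c₂, r₂, b₂, s₂⟩ := h₂ g ω M 17 ε τ₁ hM hg hε (by norm_num) hr₁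
    have hr₂ := s₂.rep (by norm_num) hr₁
    obtain ⟨t₃, τ₃, e₃, c₃, r₃, b₃, s₃⟩ := h₃ g ω M 18 ε τ₂ hM hg hε (by norm_num) hr₂
    have hr₃ := s₃.rep (by norm_num) hr₂
    obtain ⟨t₄, τ₄, e₄, c₄, r₄, s₄⟩ := cellCode_spec g ω j 17 τ₃
    have hr₄ := s₄.rep (by norm_num) hr₃
    rw [s₃.reg 17 (by norm_num), r₂, r₃] at r₄ c₄
    have r₅ : τ₄.reg 16 = v.eval g ε := by
      rw [s₄.reg 16 (by norm_num), s₃.reg 16 (by norm_num), s₂.reg 16 (by norm_num), r₁]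
    have hc := size_pair_le (pair (e.eval g ε) (f.eval g ε)) j
    have hc' := size_pair_le (e.eval g ε) (f.eval g ε)
    have := pos hM
    have hj : j.size ≤ j.size * M.size := Nat.le_mul_of_pos_right _ this
    refine ⟨_, _, .seq e₁ (.seq e₂ (.seq e₃ (.seq e₄ (.instr _ _)))), ?_, ?_⟩
    · simp only [Instr.cost, r₄, r₅]
      rw [cell]
      simp only [Nat.mul_add, Nat.add_mul, Nat.mul_assoc, Nat.mul_one]
      omega
    · refine ⟨hr₄.reg, fun j' a b => ?_, hr₄.draws⟩
      simp only [Instr.run, r₄, r₅, Function.update_apply, cell_inj, hr₄.mem, Env.put_arr]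
  | rand x e =>
    obtain ⟨K, hK⟩ := e.code_spec
    refine ⟨2 * K + 2, fun g ω M ε ε' N σ h hM hg hε hr => ?_⟩
    cases h
    obtain ⟨t₁, τ₁, e₁, c₁, r₁, b₁, s₁⟩ := hK g ω M 16 ε σ hM hg hε le_rfl hr
    have h₁ := s₁.rep le_rfl hr
    refine ⟨_, _, .seq e₁ (.instr _ _), ?_, ?_⟩
    · have := pos hM
      simp only [Instr.cost, r₁]
      nlinarith
    · have h₂ := h₁.set x (ω.draw ε.draws (e.eval g ε))
      refine ⟨?_, ?_, ?_⟩
      · simpa [Instr.run, r₁, h₁.draws] using h₂.reg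
      · simpa [Instr.run, r₁, h₁.draws] using h₂.mem
      · simp [Instr.run, h₁.draws]
  | seq p q ihp ihq =>
    obtain ⟨K, hK⟩ := ihp
    obtain ⟨K', hK'⟩ := ihq
    refine ⟨K + K', fun g ω M ε ε' N σ h hM hg hε hr => ?_⟩
    cases h with
    | seq h h' =>
    obtain ⟨t₁, τ₁, e₁, c₁, r₁⟩ := hK g ω M _ _ _ σ h hM hg hε hr
    obtain ⟨t₂, τ₂, e₂, c₂, r₂⟩ := hK' g ω M _ _ _ τ₁ h' hM hg (h.bdd hε) r₁
    refine ⟨_, _, .seq e₁ e₂, (add_le_add c₁ c₂).trans ?_, r₂⟩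
    rw [← Nat.add_mul]
    refine Nat.mul_le_mul_right _ ?_
    rw [Nat.add_mul, Nat.mul_add, Nat.mul_add]
    omega
  | ite e p q ihp ihq =>
    obtain ⟨K₀, hK₀⟩ := e.code_spec
    obtain ⟨K, hK⟩ := ihp
    obtain ⟨K', hK'⟩ := ihq
    refine ⟨2 * K₀ + 1 + K + K', fun g ω M ε ε' N σ h hM hg hε hr => ?_⟩
    obtain ⟨t₀, τ₀, e₀, c₀, r₀, b₀, s₀⟩ := hK₀ g ω M 16 ε σ hM hg hε le_rfl hr
    have hr₀ := s₀.rep le_rfl hr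
    have := pos hM
    -- One estimate for both branches; `J` is the constant of the branch taken.
    have key : ∀ (t J N : ℕ), t ≤ J * N * M.size → J ≤ K + K' →
        t₀ + (1 + (τ₀.reg 16).size + t) ≤ (2 * K₀ + 1 + K + K') * (N + 1) * M.size := by
      intro t J N ht hJ
      rw [r₀]
      have h₁ : t ≤ (K + K') * N * M.size := ht.trans (by gcongr)
      have h₂ : 0 ≤ (2 * K₀ + 1) * N * M.size := Nat.zero_le _
      have h₃ : 0 ≤ (K + K') * M.size := Nat.zero_le _
      nlinarith
    cases h with
    | ite_true h h' =>
      obtain ⟨t₁, τ₁, e₁, c₁, r₁⟩ := hK g ω M _ _ _ τ₀ h' hM hg hε hr₀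
      exact ⟨_, _, .seq e₀ (.ite_true (by rwa [r₀]) e₁), key _ _ _ c₁ (by omega), r₁⟩
    | ite_false h h' =>
      obtain ⟨t₁, τ₁, e₁, c₁, r₁⟩ := hK' g ω M _ _ _ τ₀ h' hM hg hε hr₀
      exact ⟨_, _, .seq e₀ (.ite_false (by rwa [r₀]) e₁), key _ _ _ c₁ (by omega), r₁⟩
  | loop e p ihp =>
    obtain ⟨K₀, hK₀⟩ := e.code_spec
    obtain ⟨K, hK⟩ := ihp
    -- Induction on the derivation needs a variable `s` in place of the loop. On entry the value of
    -- the guard is already in register 16.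
    have main : ∀ (g : GraphAccess) (ω : Tape) (M : ℕ) (s : Stmt) (ε ε' : Env) (N : ℕ),
        Stmt.Exec g ω M s ε N ε' → s = .loop e p → 1 ≤ M → g.Bdd M → ε.Bdd M →
        ∀ σ : State, Rep ε σ → σ.reg 16 = e.eval g ε →
        ∃ t τ, RAM.Exec g ω (.while 16 (.seq p.code (e.code 16))) σ t τ ∧
          t ≤ (2 * K₀ + 1 + K) * N * M.size ∧ Rep ε' τ := by
      intro g ω M s ε ε' N h
      induction h with
      | while_false h =>
        rintro ⟨⟩ hM hg hε σ hr hc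
        have := pos hM
        rw [h] at hc
        refine ⟨_, _, .while_false hc, ?_, hr⟩
        rw [hc, Nat.size_zero]
        nlinarith
      | @while_true e' p' ε ε₁ ε₂ N N' h hp hw _ ihw =>
        rintro ⟨⟩ hM hg hε σ hr hc
        have := pos hM
        obtain ⟨t₁, τ₁, e₁, c₁, r₁⟩ := hK g ω M _ _ _ σ hp hM hg hε hr
        have hε₁ := hp.bdd hε
        obtain ⟨t₂, τ₂, e₂, c₂, r₂, b₂, s₂⟩ := hK₀ g ω M 16 ε₁ τ₁ hM hg hε₁ le_rfl r₁
        obtain ⟨t₃, τ₃, e₃, c₃, r₃⟩ := ihw rfl hM hg hε₁ τ₂ (s₂.rep le_rfl r₁) r₂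
        -- Only the size of the guard value is wanted here, to pay for the test; the execution
        -- itself is discarded.
        obtain ⟨-, -, -, -, -, b₀, -⟩ := hK₀ g ω M 16 ε σ hM hg hε le_rfl hr
        refine ⟨_, _, .while_true (by rwa [hc]) (.seq e₁ e₂) e₃, ?_, r₃⟩
        rw [hc]
        have h₁ : 0 ≤ (2 * K₀ + 1) * N * M.size := Nat.zero_le _
        have h₂ : 0 ≤ K * M.size := Nat.zero_le _
        nlinarith
      | _ => rintro ⟨⟩
    refine ⟨3 * K₀ + 1 + K, fun g ω M ε ε' N σ h hM hg hε hr => ?_⟩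
    obtain ⟨t₀, τ₀, e₀, c₀, r₀, b₀, s₀⟩ := hK₀ g ω M 16 ε σ hM hg hε le_rfl hr
    obtain ⟨t₁, τ₁, e₁, c₁, r₁⟩ := main g ω M _ ε ε' N h rfl hM hg hε τ₀ (s₀.rep le_rfl hr) r₀
    refine ⟨_, _, .seq e₀ e₁, ?_, r₁⟩
    have hN : 1 ≤ N := by cases h <;> omega
    have : K₀ * M.size ≤ K₀ * M.size * N := Nat.le_mul_of_pos_right _ hN
    nlinarith

/-! ### Reasoning about while programs -/

/-- The program `p`, started in `ε`, halts after some number `N` of steps in a state `ε'` with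
`Q N ε'`, and never assigns a number exceeding `M`. -/
def Stmt.Run (g : GraphAccess) (ω : Tape) (M : ℕ) (p : Stmt) (ε : Env) (Q : ℕ → Env → Prop) :
    Prop :=
  ∃ N ε', Stmt.Exec g ω M p ε N ε' ∧ Q N ε'

namespace Stmt.Run

variable {g : GraphAccess} {ω : Tape} {M : ℕ} {p q : Stmt} {e f v : Ex} {ε : Env}
  {Q Q' : ℕ → Env → Prop}

theorem mono (h : Stmt.Run g ω M p ε Q) (hQ : ∀ N ε', Q N ε' → Q' N ε') :
    Stmt.Run g ω M p ε Q' :=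
  let ⟨N, ε', h₁, h₂⟩ := h
  ⟨N, ε', h₁, hQ _ _ h₂⟩

theorem skip (h : Q 1 ε) : Stmt.Run g ω M .skip ε Q := ⟨_, _, .skip _, h⟩

theorem assign {x : Fin 16} (hM : e.eval g ε ≤ M) (h : Q 1 (ε.set x (e.eval g ε))) :
    Stmt.Run g ω M (.assign x e) ε Q := ⟨_, _, .assign _ _ _ hM, h⟩

theorem store {j : ℕ} (hM : v.eval g ε ≤ M)
    (h : Q 1 (ε.put j (e.eval g ε) (f.eval g ε) (v.eval g ε))) :
    Stmt.Run g ω M (.store j e f v) ε Q := ⟨_, _, .store _ _ _ _ _ hM, h⟩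

theorem rand {x : Fin 16} (hM : ω.draw ε.draws (e.eval g ε) ≤ M)
    (h : Q 1 (ε.set x (ω.draw ε.draws (e.eval g ε))).drawn) :
    Stmt.Run g ω M (.rand x e) ε Q := ⟨_, _, .rand _ _ _ hM, h⟩

theorem seq (h : Stmt.Run g ω M p ε
      (fun N ε' => Stmt.Run g ω M q ε' (fun N' ε'' => Q (N + N') ε''))) :
    Stmt.Run g ω M (.seq p q) ε Q :=
  let ⟨_, _, h₁, _, _, h₂, h₃⟩ := h
  ⟨_, _, .seq h₁ h₂, h₃⟩

theorem ite (h : e.eval g ε ≠ 0 → Stmt.Run g ω M p ε (fun N ε' => Q (N + 1) ε'))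
    (h' : e.eval g ε = 0 → Stmt.Run g ω M q ε (fun N ε' => Q (N + 1) ε')) :
    Stmt.Run g ω M (.ite e p q) ε Q := by
  by_cases he : e.eval g ε = 0
  · obtain ⟨_, _, h₁, h₂⟩ := h' he
    exact ⟨_, _, .ite_false he h₁, h₂⟩
  · obtain ⟨_, _, h₁, h₂⟩ := h he
    exact ⟨_, _, .ite_true he h₁, h₂⟩

/-- Loops with an invariant `I` and a potential `Φ` that pays for the steps. -/
theorem loop (I : Env → Prop) (Φ : Env → ℕ) (h₀ : I ε)
    (h : ∀ ε, I ε → e.eval g ε ≠ 0 →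
      Stmt.Run g ω M p ε (fun N ε' => I ε' ∧ N + 1 + Φ ε' ≤ Φ ε))
    (hQ : ∀ N ε', I ε' → e.eval g ε' = 0 → N + Φ ε' ≤ Φ ε + 1 → Q N ε') :
    Stmt.Run g ω M (.loop e p) ε Q := by
  -- Each round lowers the potential by at least one, so induction on its value also gives
  -- termination; the extra `1` pays for the last, failing test.
  suffices H : ∀ (m : ℕ) (ε : Env), Φ ε = m → I ε → Stmt.Run g ω M (.loop e p) ε
      (fun N ε' => I ε' ∧ e.eval g ε' = 0 ∧ N + Φ ε' ≤ Φ ε + 1) from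
    (H _ ε rfl h₀).mono fun N ε' h => hQ N ε' h.1 h.2.1 h.2.2
  intro m
  induction m using Nat.strong_induction_on with
  | _ m ih =>
    intro ε hm hI
    by_cases he : e.eval g ε = 0
    · exact ⟨_, _, .while_false he, hI, he, by omega⟩
    · obtain ⟨N, ε', h₁, h₂, h₃⟩ := h ε hI he
      obtain ⟨N', ε'', h₄, h₅, h₆, h₇⟩ := ih (Φ ε') (by omega) ε' rfl h₂
      exact ⟨_, _, .while_true he h₁ h₄, h₅, h₆, by omega⟩

end Stmt.Run

end RAM

/-! ### Ball growing -/

section BallGrowing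

variable {n : ℕ}

/-- The edges between a node `w` and its parent `u`, where `P l w = u + 1` says that `u` is the
parent of `w` in the ball with label `l = c u`. -/
def treeGraph (n : ℕ) (c : ℕ → ℕ) (P : ℕ → ℕ → ℕ) : SimpleGraph (Fin n) :=
  SimpleGraph.fromRel fun u w => P (c u) w = u + 1

/-- Labels and parents are never overwritten, so tree paths, and with them all radius bounds,
survive later steps. Label 0 means "unlabelled", hence row 0 must be empty. -/
theorem treeGraph_mono {c c' : ℕ → ℕ} {P P' : ℕ → ℕ → ℕ} (h₀ : ∀ w, P 0 w = 0)
    (hc : ∀ u, c u ≠ 0 → c' u = c u) (hP : ∀ l w, P l w ≠ 0 → P' l w = P l w) :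
    treeGraph n c P ≤ treeGraph n c' P' := by
  have key : ∀ u w, P (c u) w = u + 1 → P' (c' u) w = u + 1 := by
    intro u w h
    have hu : c u ≠ 0 := by
      intro hu
      rw [hu, h₀] at h
      omega
    rw [hc u hu, hP _ _ (by omega), h]
  intro u w h
  rw [treeGraph, SimpleGraph.fromRel_adj] at h ⊢
  exact ⟨h.1, h.2.imp (key _ _) (key _ _)⟩

/-- The number of pairs of a label and a node in the ball with this label. -/
def entries (n : ℕ) (P : ℕ → ℕ → ℕ) : ℕ :=
  ((Finset.range (n + 1) ×ˢ Finset.range n).filter fun p => P p.1 p.2 ≠ 0).card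

def labelled (n : ℕ) (c : ℕ → ℕ) : ℕ :=
  ((Finset.range n).filter fun u => c u ≠ 0).card

theorem entries_insert {P P' : ℕ → ℕ → ℕ} {l w v : ℕ} (hl : l ≤ n) (hw : w < n)
    (h₀ : P l w = 0) (hv : v ≠ 0)
    (hP : ∀ l' w', P' l' w' = if l' = l ∧ w' = w then v else P l' w') :
    entries n P' = entries n P + 1 := by
  unfold entries
  rw [← Finset.card_insert_of_notMem (a := (l, w))]
  · congr 1
    ext ⟨l', w'⟩
    simp only [Finset.mem_filter, Finset.mem_product, Finset.mem_range, Finset.mem_insert,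
      Prod.mk.injEq, hP]
    by_cases h : l' = l ∧ w' = w
    · simp [h, hv]
      omega
    · simp [h]
  · simp [h₀]

theorem labelled_insert {c c' : ℕ → ℕ} {u v : ℕ} (hu : u < n) (h₀ : c u = 0) (hv : v ≠ 0)
    (hc : ∀ u', c' u' = if u' = u then v else c u') : labelled n c' = labelled n c + 1 := by
  unfold labelled
  rw [← Finset.card_insert_of_notMem (a := u)]
  · congr 1
    ext u'
    simp only [Finset.mem_filter, Finset.mem_range, Finset.mem_insert, hc]
    by_cases h : u' = u
    · simp [h, hv, hu]
    · simp [h]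
  · simp [h₀]

/-- The labels are at most `a`, the parents are neighbours, and labelled nodes are in their balls. -/
structure Forest (G : SimpleGraph (Fin n)) (a : ℕ) (c : ℕ → ℕ) (P : ℕ → ℕ → ℕ) : Prop where
  lab_le : ∀ u < n, c u ≤ a
  supp : ∀ l w, P l w ≠ 0 → w < n ∧ 1 ≤ l ∧ l ≤ a
  edge : ∀ (l : ℕ) (w : Fin n) (u : ℕ), P l w = u + 1 → u = w ∨ ∃ h : u < n, G.Adj ⟨u, h⟩ w
  self : ∀ u < n, c u ≠ 0 → P (c u) u ≠ 0

/-- For some `i < k`, the cluster `l` has radius at most `i`, and the ball `l` at most `i + 1`. -/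
def SmallRadius (n k : ℕ) (c : ℕ → ℕ) (P : ℕ → ℕ → ℕ) (l : ℕ) : Prop :=
  ∃ (z : Fin n) (i : ℕ), i < k ∧
    (∀ u : Fin n, c u = l → (treeGraph n c P).edist z u ≤ i) ∧
    ∀ w : Fin n, P l w ≠ 0 → (treeGraph n c P).edist z w ≤ (i + 1 : ℕ)

/-- The pair `(u, w)` is in the ball of `u` unless `w` was labelled before `u`. -/
def Covered (c : ℕ → ℕ) (P : ℕ → ℕ → ℕ) (u w : ℕ) : Prop :=
  (c w ≠ 0 ∧ c w ≤ c u) ∨ P (c u) w ≠ 0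

/-- The situation after the nodes below `a` have been considered as centres. -/
structure Grown (G : SimpleGraph (Fin n)) (k q : ℕ) (off smp : ℕ → ℕ) (a : ℕ) (c : ℕ → ℕ)
    (P : ℕ → ℕ → ℕ) : Prop where
  forest : Forest G a c P
  radius : ∀ l : ℕ, 1 ≤ l → l ≤ a → SmallRadius n k c P l
  done : ∀ u < a, c u ≠ 0
  cov : ∀ u < n, c u ≠ 0 → ∀ s, off u ≤ s → s < off (u + 1) → Covered c P u (smp s)
  count : entries n P ≤ q * labelled n c

/-- The situation while the ball with centre `a` grows: the nodes of the ball are in the queue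
`que`, which has length `tail`; the first `h` of them have been labelled; the current layer ends at
position `hi`. The samples of node `u₀` have been scanned only up to number `s₀`. -/
structure Growing (G : SimpleGraph (Fin n)) (k q : ℕ) (off smp : ℕ → ℕ) (a : Fin n) (c : ℕ → ℕ)
    (P : ℕ → ℕ → ℕ) (que : ℕ → ℕ) (h hi tail u₀ s₀ : ℕ) : Prop where
  forest : Forest G ((a : ℕ) + 1) c P
  radius : ∀ l : ℕ, 1 ≤ l → l ≤ a → SmallRadius n k c P l
  done : ∀ u < (a : ℕ), c u ≠ 0
  cov : ∀ u < n, c u ≠ 0 → ∀ s, off u ≤ s → s < off (u + 1) → (u = u₀ → s < s₀) →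
    Covered c P u (smp s)
  count : entries n P + q * h ≤ q * labelled n c + tail
  h_le : h ≤ hi
  hi_le : hi ≤ tail
  hi_pos : 1 ≤ hi
  que_zero : que 0 = a
  que_lt : ∀ j < tail, que j < n
  que_mem : ∀ j < tail, P ((a : ℕ) + 1) (que j) ≠ 0
  inj : ∀ i < tail, ∀ j < tail, que i = que j → i = j
  mem_que : ∀ w, P ((a : ℕ) + 1) w ≠ 0 → ∃ j < tail, que j = w
  lab : ∀ j < h, c (que j) = (a : ℕ) + 1
  unlab : ∀ j, h ≤ j → j < tail → c (que j) = 0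
  lab_que : ∀ u < n, c u = (a : ℕ) + 1 → ∃ j < h, que j = u
  depth : ∃ i < k, q ^ i ≤ hi ∧
    (∀ (u : Fin n) (j : ℕ), j < hi → que j = u → (treeGraph n c P).edist a u ≤ i) ∧
    ∀ w : Fin n, P ((a : ℕ) + 1) w ≠ 0 → (treeGraph n c P).edist a w ≤ (i + 1 : ℕ)

/-! ### Invariants between balls: persistence, initial state, skipped and new centres -/

theorem SmallRadius.mono {k l : ℕ} {c c' : ℕ → ℕ} {P P' : ℕ → ℕ → ℕ}
    (h : SmallRadius n k c P l) (hT : treeGraph n c P ≤ treeGraph n c' P')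
    (hc : ∀ u, c' u = l → c u = l) (hP : ∀ w, P' l w ≠ 0 → P l w ≠ 0) :
    SmallRadius n k c' P' l := by
  obtain ⟨z, i, hi, h₁, h₂⟩ := h
  exact ⟨z, i, hi, fun u hu => (SimpleGraph.edist_anti hT).trans (h₁ u (hc u hu)),
    fun w hw => (SimpleGraph.edist_anti hT).trans (h₂ w (hP w hw))⟩

theorem Forest.zero {G : SimpleGraph (Fin n)} {a : ℕ} {c : ℕ → ℕ} {P : ℕ → ℕ → ℕ}
    (h : Forest G a c P) (w : ℕ) : P 0 w = 0 := by
  by_contra hw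
  have := h.supp 0 w hw
  omega

variable {G : SimpleGraph (Fin n)} {k q : ℕ} {off smp : ℕ → ℕ}

theorem Grown.init {c : ℕ → ℕ} {P : ℕ → ℕ → ℕ} (hc : ∀ u, c u = 0)
    (hP : ∀ l w, P l w = 0) : Grown G k q off smp 0 c P where
  forest := ⟨fun u _ => (hc u).le, fun l w h => absurd (hP l w) h,
    fun l w u h => by rw [hP] at h; omega, fun u _ h => absurd (hc u) h⟩
  radius := fun l h₁ h₂ => by omega
  done := fun u h => by omega
  cov := fun u _ h => absurd (hc u) h
  count := by simp [entries, hP]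

/-- A node that is already labelled starts no ball: label `a + 1` stays unused, and its radius
condition is vacuous. -/
theorem Grown.skip {a : Fin n} {c : ℕ → ℕ} {P : ℕ → ℕ → ℕ} (hk : 1 ≤ k)
    (H : Grown G k q off smp a c P) (ha : c a ≠ 0) : Grown G k q off smp ((a : ℕ) + 1) c P where
  forest := ⟨fun u hu => (H.forest.lab_le u hu).trans (Nat.le_succ _),
    fun l w h => ⟨(H.forest.supp l w h).1, (H.forest.supp l w h).2.1,
      (H.forest.supp l w h).2.2.trans (Nat.le_succ _)⟩, H.forest.edge, H.forest.self⟩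
  radius := fun l h₁ h₂ => by
    rcases Nat.lt_or_ge a l with hl | hl
    · refine ⟨a, 0, hk, fun u hu => ?_, fun w hw => ?_⟩
      · have := H.forest.lab_le u u.2
        omega
      · have := H.forest.supp l w hw
        omega
    · exact H.radius l h₁ hl
  done := fun u hu => by
    rcases Nat.lt_succ_iff_lt_or_eq.1 hu with h | h
    · exact H.done u h
    · rwa [h]
  cov := H.cov
  count := H.count

/-- The centre is entered as its own parent, which adds no tree edge. Since `n` is not a node, the
trailing arguments `n 0` say that no node is partially scanned. -/
theorem Grown.start {a : Fin n} {c que : ℕ → ℕ} {P P' : ℕ → ℕ → ℕ} (hk : 1 ≤ k)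
    (H : Grown G k q off smp a c P) (ha : c a = 0) (hque : que 0 = a)
    (hP : ∀ l w, P' l w = if l = (a : ℕ) + 1 ∧ w = a then (a : ℕ) + 1 else P l w) :
    Growing G k q off smp a c P' que 0 1 1 n 0 := by
  have h₀ : ∀ w, P ((a : ℕ) + 1) w = 0 := fun w => by
    by_contra hw
    have := H.forest.supp _ w hw
    omega
  have hT : treeGraph n c P ≤ treeGraph n c P' := by
    refine treeGraph_mono H.forest.zero (fun _ _ => rfl) fun l w h => ?_
    rw [hP, if_neg]
    rintro ⟨rfl, rfl⟩
    exact h (h₀ _)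
  have hP' : ∀ l w, P l w ≠ 0 → P' l w ≠ 0 := fun l w h => by
    rw [hP]; split_ifs
    · omega
    · exact h
  have hball : ∀ w, P' ((a : ℕ) + 1) w ≠ 0 → w = a := fun w hw => by
    rw [hP] at hw
    by_contra hne
    simp [hne, h₀] at hw
  exact
  { forest :=
    { lab_le := fun u hu => (H.forest.lab_le u hu).trans (Nat.le_succ _)
      supp := fun l w h => by
        rw [hP] at h
        split_ifs at h with h'
        · exact ⟨h'.2 ▸ a.2, by omega, by omega⟩
        · exact ⟨(H.forest.supp l w h).1, (H.forest.supp l w h).2.1,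
            (H.forest.supp l w h).2.2.trans (Nat.le_succ _)⟩
      edge := fun l w u h => by
        rw [hP] at h
        split_ifs at h with h'
        · left; omega
        · exact H.forest.edge l w u h
      self := fun u hu h => hP' _ _ (H.forest.self u hu h) }
    radius := fun l h₁ h₂ => (H.radius l h₁ h₂).mono hT (fun _ h => h) fun w hw => by
      rw [hP, if_neg (by omega)] at hw
      exact hw
    done := H.done
    cov := fun u hu h s h₁ h₂ _ => (H.cov u hu h s h₁ h₂).imp_right (hP' _ _)
    count := by
      rw [entries_insert (l := (a : ℕ) + 1) (w := a) (v := (a : ℕ) + 1) a.2 a.2 (h₀ _) (by omega) hP]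
      have := H.count
      omega
    h_le := zero_le
    hi_le := le_rfl
    hi_pos := le_rfl
    que_zero := hque
    que_lt := fun j hj => by rw [Nat.lt_one_iff.1 hj, hque]; exact a.2
    que_mem := fun j hj => by rw [Nat.lt_one_iff.1 hj, hque, hP]; simp
    inj := fun i hi j hj _ => by omega
    mem_que := fun w hw => ⟨0, one_pos, by rw [hque, hball w hw]⟩
    lab := fun j hj => by omega
    unlab := fun j _ hj => by rw [Nat.lt_one_iff.1 hj, hque, ha]
    lab_que := fun u hu h => by
      have := H.forest.lab_le u hu
      omega
    depth := by
      refine ⟨0, hk, by simp, fun u j hj h => ?_, fun w hw => ?_⟩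
      · rw [Nat.lt_one_iff.1 hj, hque] at h
        rw [Fin.ext h, SimpleGraph.edist_self]
        exact zero_le
      · rw [Fin.ext (hball w hw), SimpleGraph.edist_self]
        exact zero_le }

/-! ### Invariants inside a ball: labelling, scanning, next layer, end of growth -/

namespace Growing

variable {a : Fin n} {c : ℕ → ℕ} {P : ℕ → ℕ → ℕ} {que : ℕ → ℕ} {h hi tail u₀ s₀ : ℕ}

theorem tail_le (H : Growing G k q off smp a c P que h hi tail u₀ s₀) : tail ≤ n := by
  have := Finset.card_le_card_of_injOn (s := Finset.range tail) (t := Finset.range n) que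
    (fun j hj => by simpa using H.que_lt j (by simpa using hj))
    (fun i hi j hj => H.inj i (by simpa using hi) j (by simpa using hj))
  simpa using this

/-- Once the samples of `u₀` are exhausted, the exemption from coverage is void and can be moved to
the non-node `n`. -/
theorem close (H : Growing G k q off smp a c P que h hi tail u₀ s₀)
    (hs : off (u₀ + 1) ≤ s₀) : Growing G k q off smp a c P que h hi tail n 0 :=
  { H with
    cov := fun u hu hc s h₁ h₂ _ => H.cov u hu hc s h₁ h₂ fun hu => by subst hu; omega }

/-- The newly labelled node owes coverage for none of its samples yet, because the scan position is
its first sample. Pairs covered before stay covered. -/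
theorem label (H : Growing G k q off smp a c P que h hi tail n 0) (hh : h < hi) {c' : ℕ → ℕ}
    (hc : ∀ u, c' u = if u = que h then (a : ℕ) + 1 else c u) :
    Growing G k q off smp a c' P que (h + 1) hi tail (que h) (off (que h)) := by
  have hht : h < tail := hh.trans_le H.hi_le
  have hu := H.que_lt h hht
  have h₀ := H.unlab h le_rfl hht
  have hcc : ∀ u, c u ≠ 0 → c' u = c u := fun u hcu => by
    rw [hc, if_neg]
    rintro rfl
    exact hcu h₀
  have hT : treeGraph n c P ≤ treeGraph n c' P :=
    treeGraph_mono H.forest.zero hcc fun _ _ _ => rfl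
  exact
  { H with
    forest :=
    { H.forest with
      lab_le := fun u hu => by
        rw [hc]; split_ifs
        · exact le_rfl
        · exact H.forest.lab_le u hu
      self := fun u hu h => by
        rw [hc] at h ⊢
        split_ifs at h ⊢ with h'
        · rw [h']; exact H.que_mem _ hht
        · exact H.forest.self u hu h }
    radius := fun l h₁ h₂ => (H.radius l h₁ h₂).mono hT (fun u hu => by
      rw [hc] at hu
      split_ifs at hu
      · omega
      · exact hu) fun _ h => h
    done := fun u hu => by rw [hcc u (H.done u hu)]; exact H.done u hu
    cov := fun u hu h s h₁ h₂ h₃ => by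
      have hne : u ≠ que _ := fun h' => by
        have := h₃ h'
        rw [← h'] at this
        omega
      have hcu : c u ≠ 0 := by rwa [hc, if_neg hne] at h
      rcases H.cov u hu hcu s h₁ h₂ (fun h => by omega) with h' | h'
      · left
        rw [hcc u hcu, hcc _ h'.1]
        exact h'
      · right
        rwa [hcc u hcu]
    count := by
      rw [labelled_insert hu h₀ (by omega) hc]
      have := H.count
      simp only [Nat.mul_add]
      omega
    h_le := hh
    lab := fun j hj => by
      rw [hc]
      split_ifs with h'
      · rfl
      · refine H.lab j ?_
        rcases Nat.lt_succ_iff_lt_or_eq.1 hj with h'' | h''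
        · exact h''
        · exact absurd (by rw [h'']) h'
    unlab := fun j hj hjt => by
      rw [hc, if_neg]
      · exact H.unlab j (by omega) hjt
      · intro h'
        have := H.inj _ hjt _ hht h'
        omega
    lab_que := fun u hu hcu => by
      rw [hc] at hcu
      split_ifs at hcu with h'
      · exact ⟨h, by omega, h'.symm⟩
      · obtain ⟨j, hj, hj'⟩ := H.lab_que u hu hcu
        exact ⟨j, by omega, hj'⟩
    depth := by
      obtain ⟨i, hi, h₁, h₂, h₃⟩ := H.depth
      exact ⟨i, hi, h₁, fun u j hj hu => (SimpleGraph.edist_anti hT).trans (h₂ u j hj hu),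
        fun w hw => (SimpleGraph.edist_anti hT).trans (h₃ w hw)⟩ }

/-- A sampled node in the current ball is covered by its entry; a labelled one is covered because no
label so far exceeds that of the scanned node. -/
theorem skip (H : Growing G k q off smp a c P que (h + 1) hi tail (que h) s₀)
    (hw : c (smp s₀) + P ((a : ℕ) + 1) (smp s₀) ≠ 0) (hlt : smp s₀ < n) :
    Growing G k q off smp a c P que (h + 1) hi tail (que h) (s₀ + 1) :=
  { H with
    cov := fun u hu hcu s h₁ h₂ h₃ => by
      by_cases hs : u = que h ∧ s = s₀
      · obtain ⟨rfl, rfl⟩ := hs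
        have hl : c (que h) = (a : ℕ) + 1 := H.lab h (Nat.lt_succ_self h)
        by_cases hcw : c (smp s) = 0
        · right
          rw [hl]
          omega
        · left
          rw [hl]
          exact ⟨hcw, H.forest.lab_le _ hlt⟩
      · exact H.cov u hu hcu s h₁ h₂ fun hu' => by
          have := h₃ hu'
          have : s ≠ s₀ := fun h' => hs ⟨hu', h'⟩
          omega }

/-- The scanned node sits at a queue position before `hi`, so its depth is at most `i`, and its new
child has depth at most `i + 1`. One entry and one queue place are added, which keeps `count`
balanced. -/
theorem push (H : Growing G k q off smp a c P que (h + 1) hi tail (que h) s₀)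
    (hw : c (smp s₀) + P ((a : ℕ) + 1) (smp s₀) = 0) {u : Fin n} (hu : que h = u) {w : Fin n}
    (hw' : smp s₀ = w) (hG : G.Adj u w) {P' : ℕ → ℕ → ℕ} {que' : ℕ → ℕ}
    (hP : ∀ l x, P' l x = if l = (a : ℕ) + 1 ∧ x = smp s₀ then que h + 1 else P l x)
    (hque : ∀ j, que' j = if j = tail then smp s₀ else que j) :
    Growing G k q off smp a c P' que' (h + 1) hi (tail + 1) (que' h) (s₀ + 1) := by
  have h₁ := H.h_le
  have h₂ := H.hi_le
  have hcw : c w = 0 := by rw [← hw']; omega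
  have hPw : P ((a : ℕ) + 1) w = 0 := by rw [← hw']; omega
  rw [hw'] at hP hque
  have hlab : c u = (a : ℕ) + 1 := by rw [← hu]; exact H.lab h (Nat.lt_succ_self h)
  have hP' : ∀ l x, P l x ≠ 0 → P' l x = P l x := fun l x hx => by
    rw [hP, if_neg]
    rintro ⟨rfl, rfl⟩
    exact hx hPw
  have hP'' : ∀ l x, P l x ≠ 0 → P' l x ≠ 0 := fun l x hx => by rwa [hP' l x hx]
  have hq : ∀ j < tail, que' j = que j := fun j hj => by rw [hque, if_neg (by omega)]
  have hT : treeGraph n c P ≤ treeGraph n c P' :=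
    treeGraph_mono H.forest.zero (fun _ _ => rfl) hP'
  have hTuw : (treeGraph n c P').Adj u w := by
    rw [treeGraph, SimpleGraph.fromRel_adj]
    exact ⟨hG.ne, Or.inl (by rw [hP, hlab]; simp [hu])⟩
  have hne : ∀ j < tail, que j ≠ w := fun j hj h' => H.que_mem j hj (by rw [h', hPw])
  exact
  { forest :=
    { lab_le := H.forest.lab_le
      supp := fun l x hx => by
        rw [hP] at hx
        split_ifs at hx with h'
        · exact ⟨h'.2 ▸ w.2, by omega, by omega⟩
        · exact H.forest.supp l x hx
      edge := fun l x v hv => by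
        rw [hP] at hv
        split_ifs at hv with h'
        · right
          have hv' : v = u := by omega
          subst hv'
          have hx : x = w := Fin.ext h'.2
          subst hx
          exact ⟨u.2, hG⟩
        · exact H.forest.edge l x v hv
      self := fun v hv hcv => hP'' _ _ (H.forest.self v hv hcv) }
    radius := fun l h₁ h₂ => (H.radius l h₁ h₂).mono hT (fun _ h => h) fun x hx => by
      rw [hP, if_neg (by omega)] at hx
      exact hx
    done := H.done
    cov := fun v hv hcv s hs₁ hs₂ hs₃ => by
      rw [hq h (by omega)] at hs₃
      by_cases hs : v = que h ∧ s = s₀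
      · obtain ⟨rfl, rfl⟩ := hs
        right
        rw [hu, hlab, hw', hP]
        simp
      · exact (H.cov v hv hcv s hs₁ hs₂ fun hv' => by
          have := hs₃ hv'
          have : s ≠ s₀ := fun h' => hs ⟨hv', h'⟩
          omega).imp_right (hP'' _ _)
    count := by
      rw [entries_insert (by omega) w.2 hPw (by omega) hP]
      have := H.count
      omega
    h_le := h₁
    hi_le := by omega
    hi_pos := H.hi_pos
    que_zero := by rw [hq 0 (by omega)]; exact H.que_zero
    que_lt := fun j hj => by
      rw [hque]; split_ifs
      · exact w.2
      · exact H.que_lt j (by omega)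
    que_mem := fun j hj => by
      rw [hque]; split_ifs
      · rw [hP]; simp
      · exact hP'' _ _ (H.que_mem j (by omega))
    inj := fun i hi j hj hij => by
      rw [hque, hque] at hij
      split_ifs at hij
      · omega
      · exact absurd hij.symm (hne j (by omega))
      · exact absurd hij (hne i (by omega))
      · exact H.inj i (by omega) j (by omega) hij
    mem_que := fun x hx => by
      rw [hP] at hx
      split_ifs at hx with h'
      · exact ⟨tail, by omega, by rw [hque, if_pos rfl, h'.2]⟩
      · obtain ⟨j, hj, hj'⟩ := H.mem_que x hx
        exact ⟨j, by omega, by rw [hq j hj, hj']⟩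
    lab := fun j hj => by rw [hq j (by omega)]; exact H.lab j hj
    unlab := fun j hj hjt => by
      rw [hque]; split_ifs
      · exact hcw
      · exact H.unlab j hj (by omega)
    lab_que := fun v hv hcv => by
      obtain ⟨j, hj, hj'⟩ := H.lab_que v hv hcv
      exact ⟨j, hj, by rw [hq j (by omega), hj']⟩
    depth := by
      obtain ⟨i, hi, d₁, d₂, d₃⟩ := H.depth
      refine ⟨i, hi, d₁, fun v j hj hv => (SimpleGraph.edist_anti hT).trans
        (d₂ v j hj (by rw [← hv, hq j (by omega)])), fun x hx => ?_⟩
      by_cases hxw : x = w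
      · subst hxw
        calc (treeGraph n c P').edist a x
            ≤ (treeGraph n c P').edist a u + (treeGraph n c P').edist u x :=
              SimpleGraph.edist_triangle
          _ ≤ (i : ℕ∞) + 1 := add_le_add
              ((SimpleGraph.edist_anti hT).trans (d₂ u h (by omega) hu))
              (SimpleGraph.edist_eq_one_iff_adj.2 hTuw).le
          _ = ((i + 1 : ℕ) : ℕ∞) := by push_cast; rfl
      · rw [hP, if_neg (fun h' => hxw (Fin.ext h'.2))] at hx
        exact (SimpleGraph.edist_anti hT).trans (d₃ x hx) }

/-- This is where the radius is bounded: q^(i+1) ≤ q · `hi` < `tail` ≤ n ≤ q^k forces i + 1 < k. -/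
theorem layer (H : Growing G k q off smp a c P que h hi tail n 0) (hq : 1 ≤ q) (hn : n ≤ q ^ k)
    (hh : h = hi) (ht : q * hi < tail) : Growing G k q off smp a c P que h tail tail n 0 := by
  have h₂ := H.hi_le
  refine { H with h_le := by omega, hi_le := le_rfl, hi_pos := by omega, depth := ?_ }
  obtain ⟨i, hi, d₁, d₂, d₃⟩ := H.depth
  have hpow : q ^ (i + 1) < tail := by
    rw [pow_succ']
    exact (Nat.mul_le_mul_left q d₁).trans_lt ht
  have hik : i + 1 < k := by
    by_contra hki
    have := Nat.pow_le_pow_right hq (Nat.le_of_not_lt hki)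
    have := H.tail_le
    omega
  refine ⟨i + 1, hik, hpow.le, fun u j hj hu => d₃ u (hu ▸ H.que_mem j hj), fun w hw =>
    (d₃ w hw).trans ?_⟩
  exact_mod_cast Nat.le_succ _

/-- All `hi` nodes of the cluster are labelled and the ball has at most `q * hi` entries, so the
cluster pays for its ball and `count` loses its correction terms. -/
theorem finish (H : Growing G k q off smp a c P que h hi tail n 0)
    (hh : h = hi) (ht : tail ≤ q * hi) : Grown G k q off smp ((a : ℕ) + 1) c P where
  forest := H.forest
  radius := fun l h₁ h₂ => by
    rcases Nat.lt_or_ge a l with hl | hl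
    · obtain rfl : l = (a : ℕ) + 1 := by omega
      obtain ⟨i, hi, d₁, d₂, d₃⟩ := H.depth
      refine ⟨a, i, hi, fun u hu => ?_, d₃⟩
      obtain ⟨j, hj, hj'⟩ := H.lab_que u u.2 hu
      exact d₂ u j (by omega) hj'
    · exact H.radius l h₁ hl
  done := fun u hu => by
    rcases Nat.lt_succ_iff_lt_or_eq.1 hu with h' | h'
    · exact H.done u h'
    · have := H.hi_pos
      have := H.lab 0 (by omega)
      rw [H.que_zero] at this
      rw [h', this]
      omega
  cov := fun u hu hc s h₁ h₂ => H.cov u hu hc s h₁ h₂ fun h => by omega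
  count := by
    have := H.count
    rw [hh] at this
    omega

end Growing

end BallGrowing

namespace RAM

/-! ### The preprocessing program

Variables: `0` number of nodes, `1` stretch parameter, `2` sampling parameter, `3` growth factor,
`4` power of the growth factor, `5` exponent, `6` node, `7` sample number, `8` degree, `9` number of
samples left, `10` centre, `11` queue position, `12` end of the layer, `13` length of the queue,
`14` node in the queue, `15` neighbour.

Arrays: `0` first sample numbers, `1` samples, `2` labels, `3` parents, `4` queue. -/

instance (a : ℕ) : OfNat Ex a := ⟨.cst a⟩
instance : Add Ex := ⟨.op .add⟩
instance : Sub Ex := ⟨.op .sub⟩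
instance : Mul Ex := ⟨.op .mul⟩
instance : Div Ex := ⟨.op .div⟩

section Eval

variable (g : GraphAccess) (ε : Env) (e f : Ex)

@[simp] theorem Ex.eval_var (x : Fin 16) : (Ex.var x).eval g ε = ε.reg x := rfl
@[simp] theorem Ex.eval_ofNat (a : ℕ) : (no_index (OfNat.ofNat a : Ex)).eval g ε = a := rfl
@[simp] theorem Ex.eval_zero : (0 : Ex).eval g ε = 0 := rfl
@[simp] theorem Ex.eval_one : (1 : Ex).eval g ε = 1 := rfl
@[simp] theorem Ex.eval_add : (e + f).eval g ε = e.eval g ε + f.eval g ε := rfl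
@[simp] theorem Ex.eval_sub : (e - f).eval g ε = e.eval g ε - f.eval g ε := rfl
@[simp] theorem Ex.eval_mul : (e * f).eval g ε = e.eval g ε * f.eval g ε := rfl
@[simp] theorem Ex.eval_div : (e / f).eval g ε = e.eval g ε / f.eval g ε := rfl
@[simp] theorem Ex.eval_arr (j : ℕ) :
    (Ex.arr j e f).eval g ε = ε.arr j (e.eval g ε) (f.eval g ε) := rfl
@[simp] theorem Ex.eval_deg : (Ex.deg e).eval g ε = g.deg (e.eval g ε) := rfl
@[simp] theorem Ex.eval_nbr : (Ex.nbr e f).eval g ε = g.nbr (e.eval g ε) (f.eval g ε) := rfl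
@[simp] theorem Ex.eval_adj : (Ex.adj e f).eval g ε = g.adj (e.eval g ε) (f.eval g ε) := rfl

end Eval

/-- Computes the least `q` with `n ≤ q ^ k`. -/
def rootProg : Stmt :=
  -- A truncated difference x - y is nonzero exactly if y < x, so it serves as a comparison, here
  -- and in the later guards.
  .loop (.var 0 - .var 4)
    (.seq (.assign 3 (.var 3 + 1))
    (.seq (.assign 4 1)
    (.seq (.assign 5 (.var 1))
    (.loop (.var 5)
      (.seq (.assign 4 (.var 4 * .var 3))
      (.assign 5 (.var 5 - 1)))))))

/-- Draws samples from all adjacency lists. -/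
def sampleProg : Stmt :=
  .seq (.assign 6 0)
  (.seq (.assign 7 0)
  (.seq (.loop (.var 0 - .var 6)
    (.seq (.store 0 0 (.var 6) (.var 7))
    (.seq (.assign 8 (.deg (.var 6)))
    -- The quotient degree / parameter, rounded up: every node with a neighbour gets a sample.
    (.seq (.assign 9 ((.var 8 + (.var 2 - 1)) / .var 2))
    (.seq (.loop (.var 9)
      (.seq (.rand 15 (.var 8))
      (.seq (.store 1 0 (.var 7) (.nbr (.var 6) (.var 15)))
      (.seq (.assign 7 (.var 7 + 1))
      (.assign 9 (.var 9 - 1))))))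
    (.assign 6 (.var 6 + 1)))))))
  (.store 0 0 (.var 0) (.var 7))))

/-- Scans the samples of the node in variable `14`. -/
def scanProg : Stmt :=
  .loop (.arr 0 0 (.var 14 + 1) - .var 7)
    (.seq (.assign 15 (.arr 1 0 (.var 7)))
    -- The sum acts as a disjunction: already labelled, or already in the current ball.
    (.seq (.ite (.arr 2 0 (.var 15) + .arr 3 (.var 10 + 1) (.var 15)) .skip
      (.seq (.store 3 (.var 10 + 1) (.var 15) (.var 14 + 1))
      (.seq (.store 4 0 (.var 13) (.var 15))
      (.assign 13 (.var 13 + 1)))))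
    (.assign 7 (.var 7 + 1))))

/-- Grows the ball with the centre in variable `10`. -/
def ballProg : Stmt :=
  .seq (.store 3 (.var 10 + 1) (.var 10) (.var 10 + 1))
  (.seq (.store 4 0 0 (.var 10))
  (.seq (.assign 11 0)
  (.seq (.assign 12 1)
  (.seq (.assign 13 1)
  (.loop (.var 12 - .var 11)
    (.seq (.assign 14 (.arr 4 0 (.var 11)))
    (.seq (.store 2 0 (.var 14) (.var 10 + 1))
    (.seq (.assign 7 (.arr 0 0 (.var 14)))
    (.seq scanProg
    (.seq (.assign 11 (.var 11 + 1))
    (.ite (.var 12 - .var 11) .skip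
      -- If the ball has grown by more than the factor, the next layer is opened; otherwise the loop
      -- guard is now zero and growth ends.
      (.ite (.var 13 - .var 3 * .var 12) (.assign 12 (.var 13)) .skip))))))))))))

def growProg : Stmt :=
  .seq (.assign 10 0)
  (.loop (.var 0 - .var 10)
    (.seq (.ite (.arr 2 0 (.var 10)) .skip ballProg)
    (.assign 10 (.var 10 + 1))))

def preProg : Stmt := .seq rootProg (.seq sampleProg growProg)

/-- A linear search is affordable: x ≤ x^k < n for every rejected x, so there are at most n rounds
of O(k) steps, and all powers formed are at most n^k. -/
theorem rootProg_run {g : GraphAccess} {ω : Tape} {M n k : ℕ} {ε : Env} (hn : 1 ≤ n) (hk : 1 ≤ k)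
    (hM : n ^ k ≤ M) (hnM : n ≤ M) (hkM : k ≤ M) (h₀ : ε.reg 0 = n) (h₁ : ε.reg 1 = k)
    (h₃ : ε.reg 3 = 0) (h₄ : ε.reg 4 = 0) :
    Stmt.Run g ω M rootProg ε fun N ε' =>
      N ≤ n * (3 * k + 5) + 1 ∧ ε'.reg 0 = n ∧ ε'.reg 1 = k ∧ ε'.reg 2 = ε.reg 2 ∧
      ε'.arr = ε.arr ∧ ε'.draws = ε.draws ∧
      1 ≤ ε'.reg 3 ∧ n ≤ ε'.reg 3 ^ k ∧ (ε'.reg 3 - 1) ^ k < n := by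
  have hle : ∀ x, x ^ k < n → x < n := fun x hx => (Nat.le_self_pow (by omega) x).trans_lt hx
  refine .loop
    (fun ε' => ε'.reg 0 = n ∧ ε'.reg 1 = k ∧ ε'.reg 2 = ε.reg 2 ∧ ε'.arr = ε.arr ∧
      ε'.draws = ε.draws ∧ ε'.reg 4 = ε'.reg 3 ^ k ∧ (ε'.reg 3 - 1) ^ k < n)
    (fun ε' => (n - ε'.reg 3) * (3 * k + 5)) ?_ ?_ ?_
  · refine ⟨h₀, h₁, rfl, rfl, rfl, ?_, ?_⟩
    · rw [h₃, h₄, zero_pow (by omega)]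
    · rw [h₃, Nat.zero_sub, zero_pow (by omega)]
      omega
  · rintro ε₁ ⟨i₀, i₁, i₂, i₃, i₄, i₅, -⟩ hc
    simp only [Ex.eval_sub, Ex.eval_var, i₀] at hc
    have hlt := hle (ε₁.reg 3) (by omega)
    refine .seq (.assign (by simp; omega) ?_)
    refine .seq (.assign (by simp; omega) ?_)
    refine .seq (.assign (by simp [i₁]; omega) ?_)
    refine .loop
      (fun ε' => ε'.reg 0 = n ∧ ε'.reg 1 = k ∧ ε'.reg 2 = ε.reg 2 ∧ ε'.arr = ε.arr ∧
        ε'.draws = ε.draws ∧ ε'.reg 3 = ε₁.reg 3 + 1 ∧ ε'.reg 5 ≤ k ∧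
        ε'.reg 4 * (ε₁.reg 3 + 1) ^ ε'.reg 5 = (ε₁.reg 3 + 1) ^ k)
      (fun ε' => 3 * ε'.reg 5) ?_ ?_ ?_
    · simp [i₀, i₁, i₂, i₃, i₄]
    · rintro ε₂ ⟨j₀, j₁, j₂, j₃, j₄, j₅, j₇, j₆⟩ hd
      simp only [Ex.eval_var] at hd
      obtain ⟨i, hi⟩ := Nat.exists_eq_succ_of_ne_zero hd
      have hprod : ε₂.reg 4 * (ε₁.reg 3 + 1) * (ε₁.reg 3 + 1) ^ i = (ε₁.reg 3 + 1) ^ k := by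
        rw [← j₆, hi, pow_succ', mul_assoc]
      have hpos : 1 ≤ (ε₁.reg 3 + 1) ^ i := Nat.one_le_pow _ _ (by omega)
      have hpow : (ε₁.reg 3 + 1) ^ k ≤ n ^ k := Nat.pow_le_pow_left (by omega) k
      refine .seq (.assign ?_ ?_)
      · simp only [Ex.eval_mul, Ex.eval_var, j₅]
        calc _ ≤ ε₂.reg 4 * (ε₁.reg 3 + 1) * (ε₁.reg 3 + 1) ^ i := Nat.le_mul_of_pos_right _ hpos
          _ ≤ M := by rw [hprod]; omega
      · refine .assign (by simp; omega) ?_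
        simp [j₀, j₁, j₂, j₃, j₄, j₅, hi, hprod]
        omega
    · rintro N ε₂ ⟨j₀, j₁, j₂, j₃, j₄, j₅, j₇, j₆⟩ hd hN
      simp only [Ex.eval_var] at hd
      simp only [Env.set_reg, hd, pow_zero, mul_one] at hN j₆
      refine ⟨⟨j₀, j₁, j₂, j₃, j₄, by rw [j₆, j₅], ?_⟩, ?_⟩
      · rw [j₅, Nat.add_sub_cancel]
        omega
      · simp [i₁] at hN
        rw [j₅]
        obtain ⟨m, hm⟩ : ∃ m, n - ε₁.reg 3 = m + 1 := ⟨n - ε₁.reg 3 - 1, by omega⟩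
        rw [hm, show n - (ε₁.reg 3 + 1) = m by omega, Nat.add_mul]
        omega
  · rintro N ε' ⟨i₀, i₁, i₂, i₃, i₄, i₅, i₆⟩ hc hN
    simp only [Ex.eval_sub, Ex.eval_var, i₀] at hc
    refine ⟨?_, i₀, i₁, i₂, i₃, i₄, ?_, by omega, i₆⟩
    · rw [h₃] at hN
      simp only [Nat.sub_zero] at hN
      omega
    · by_contra h
      rw [show ε'.reg 3 = 0 by omega, zero_pow (by omega)] at i₅
      omega

/-! ### Sampling -/

/-- The number of samples taken from the adjacency list of `v`. -/
def sampleCount (g : GraphAccess) (r v : ℕ) : ℕ := (g.deg v + (r - 1)) / r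

/-- The number of the first sample taken from the adjacency list of `v`. -/
def sampleStart (g : GraphAccess) (r v : ℕ) : ℕ := ∑ u ∈ Finset.range v, sampleCount g r u

theorem sampleStart_succ (g : GraphAccess) (r v : ℕ) :
    sampleStart g r (v + 1) = sampleStart g r v + sampleCount g r v := Finset.sum_range_succ _ _

theorem sampleStart_mono (g : GraphAccess) (r : ℕ) : Monotone (sampleStart g r) :=
  monotone_nat_of_le_succ fun v => by rw [sampleStart_succ]; omega

theorem Tape.draw_le (ω : Tape) (t b : ℕ) : ω.draw t b ≤ b := by
  unfold Tape.draw
  split_ifs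
  · omega
  · have := (ω (t, b - 1)).2
    omega

/-- The number of draws made always equals the number of the next sample. Hence sample s is a
function of draw s alone, which later yields independence. -/
theorem sampleProg_run {g : GraphAccess} {ω : Tape} {M n r : ℕ} {ε : Env} (hg : g.Bdd M)
    (hnM : n ≤ M) (hM : sampleStart g r n ≤ M)
    (h₀ : ε.reg 0 = n) (h₂ : ε.reg 2 = r) (hd : ε.draws = 0) (hA : ∀ j a b, ε.arr j a b = 0) :
    Stmt.Run g ω M sampleProg ε fun N ε' =>
      N ≤ 6 * n + 5 * sampleStart g r n + 4 ∧ ε'.reg 0 = n ∧ ε'.reg 3 = ε.reg 3 ∧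
      (∀ v ≤ n, ε'.arr 0 0 v = sampleStart g r v) ∧
      (∀ v < n, ∀ s, sampleStart g r v ≤ s → s < sampleStart g r (v + 1) →
        ε'.arr 1 0 s = g.nbr v (ω.draw s (g.deg v))) ∧
      (∀ a b, ε'.arr 2 a b = 0) ∧ (∀ a b, ε'.arr 3 a b = 0) := by
  have hmono := sampleStart_mono g r
  refine .seq (.assign (by simp) (.seq (.assign (by simp) (.seq (.loop
    (fun ε' => ε'.reg 0 = n ∧ ε'.reg 2 = r ∧ ε'.reg 3 = ε.reg 3 ∧ ε'.reg 6 ≤ n ∧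
      ε'.reg 7 = sampleStart g r (ε'.reg 6) ∧ ε'.draws = ε'.reg 7 ∧
      (∀ v < ε'.reg 6, ε'.arr 0 0 v = sampleStart g r v) ∧
      (∀ v < ε'.reg 6, ∀ s, sampleStart g r v ≤ s → s < sampleStart g r (v + 1) →
        ε'.arr 1 0 s = g.nbr v (ω.draw s (g.deg v))) ∧
      (∀ a b, ε'.arr 2 a b = 0) ∧ (∀ a b, ε'.arr 3 a b = 0))
    (fun ε' => 6 * (n - ε'.reg 6) + 5 * (sampleStart g r n - ε'.reg 7)) ?_ ?_ ?_)))))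
  · simp [h₀, h₂, hd, hA, sampleStart]
  · rintro ε₁ ⟨i₀, i₁, i₂, i₃, i₄, i₅, i₆, i₇, i₈, i₉⟩ hc
    simp only [Ex.eval_sub, Ex.eval_var, i₀] at hc
    obtain ⟨v, hv⟩ : ∃ v, v = ε₁.reg 6 := ⟨_, rfl⟩
    rw [← hv] at i₃ i₄ i₆ i₇ hc
    have hs := sampleStart_succ g r v
    have hle := hmono (show v + 1 ≤ n by omega)
    refine .seq (.store (by simp; omega) (.seq (.assign (by simpa using hg.deg _)
      (.seq (.assign ?_ (.seq (.loop
        (fun ε' => ε'.reg 0 = n ∧ ε'.reg 2 = r ∧ ε'.reg 3 = ε.reg 3 ∧ ε'.reg 6 = v ∧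
          ε'.reg 8 = g.deg v ∧ sampleStart g r v ≤ ε'.reg 7 ∧ ε'.reg 7 + ε'.reg 9 = sampleStart g r (v + 1) ∧
          ε'.draws = ε'.reg 7 ∧
          (∀ u < v + 1, ε'.arr 0 0 u = sampleStart g r u) ∧
          (∀ u < v + 1, ∀ s, sampleStart g r u ≤ s → s < sampleStart g r (u + 1) →
            s < ε'.reg 7 → ε'.arr 1 0 s = g.nbr u (ω.draw s (g.deg u))) ∧
          (∀ a b, ε'.arr 2 a b = 0) ∧ (∀ a b, ε'.arr 3 a b = 0))
        (fun ε' => 5 * ε'.reg 9) ?_ ?_ ?_)))))))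
    · simp [i₁, ← hv]
      rw [← sampleCount]
      omega
    · simp [i₀, i₁, i₂, i₅, i₈, i₉, ← hv, i₄, hs, sampleCount]
      refine ⟨fun u hu => ?_, fun u hu s h₁ h₂ h₃ => ?_⟩
      · split_ifs with h
        · rw [h]
        · exact i₆ u (by omega)
      · refine i₇ u ?_ s h₁ h₂
        by_contra hne
        have := hmono (show v ≤ u by omega)
        omega
    · rintro ε₂ ⟨j₀, j₁, j₂, j₃, j₄, j₁₁, j₅, j₆, j₇, j₈, j₉, j₁₀⟩ hd
      simp only [Ex.eval_var] at hd
      refine .seq (.rand ((Tape.draw_le _ _ _).trans (by simpa [j₄] using hg.deg _))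
        (.seq (.store (by simpa using hg.nbr _ _) (.seq (.assign (by simp; omega)
        (.assign (by simp; omega) ?_))))))
      simp [j₀, j₁, j₂, j₃, j₄, j₆, j₉, j₁₀]
      refine ⟨⟨by omega, by omega, fun u hu => j₇ u (by omega), fun u hu s h₁ h₂ h₃ => ?_⟩, by omega⟩
      split_ifs with h
      · have hu' : u = v := by
          by_contra hne
          have := hmono (show u + 1 ≤ v by omega)
          omega
        rw [h, hu']
      · exact j₈ u (by omega) s h₁ h₂ (by omega)
    · rintro N ε₂ ⟨j₀, j₁, j₂, j₃, j₄, j₁₁, j₅, j₆, j₇, j₈, j₉, j₁₀⟩ hd hN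
      simp only [Ex.eval_var] at hd
      simp [i₁, ← hv] at hN
      rw [← sampleCount] at hN
      refine .assign (by simp; omega) ?_
      simp [j₀, j₁, j₂, j₃, j₆, j₉, j₁₀]
      refine ⟨⟨by omega, by omega, fun u hu => j₇ u (by omega), fun u hu s h₁ h₂ => ?_⟩, ?_⟩
      · have := hmono (show u + 1 ≤ v + 1 by omega)
        exact j₈ u (by omega) s h₁ h₂ (by omega)
      · omega
  · rintro N ε₁ ⟨i₀, i₁, i₂, i₃, i₄, i₅, i₆, i₇, i₈, i₉⟩ hc hN
    simp only [Ex.eval_sub, Ex.eval_var, i₀] at hc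
    have hv : ε₁.reg 6 = n := by omega
    rw [hv] at i₄ i₆ i₇
    simp at hN
    refine .store (by simp; omega) ?_
    simp [i₀, i₂, i₄, i₈, i₉]
    refine ⟨by omega, fun v hv => ?_, i₇⟩
    split_ifs with h
    · rw [h]
    · exact i₆ v (by omega)

end RAM

namespace RAM

/-! ### Growing the balls -/

/-- The data that stay the same while the balls grow. -/
structure Fixed (n q : ℕ) (off smp : ℕ → ℕ) (ε : Env) : Prop where
  nodes : ε.reg 0 = n
  factor : ε.reg 3 = q
  start : ∀ v ≤ n, ε.arr 0 0 v = off v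
  sample : ∀ s, ε.arr 1 0 s = smp s

/-- The cost of scanning the unlabelled nodes. -/
def unscanned (n : ℕ) (off c : ℕ → ℕ) : ℕ :=
  ∑ u ∈ Finset.range n, if c u = 0 then 12 + 10 * (off (u + 1) - off u) else 0

/-- Labelling a node releases the budget for scanning its samples. As a node is labelled only once,
all balls together take O(n + number of samples) steps. -/
theorem unscanned_label {n : ℕ} {off c c' : ℕ → ℕ} {u v : ℕ} (hu : u < n) (h₀ : c u = 0)
    (hv : v ≠ 0) (hc : ∀ u', c' u' = if u' = u then v else c u') :
    unscanned n off c = unscanned n off c' + (12 + 10 * (off (u + 1) - off u)) := by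
  unfold unscanned
  have hu' : u ∈ Finset.range n := Finset.mem_range.2 hu
  rw [← Finset.add_sum_erase _ _ hu', ← Finset.add_sum_erase _ _ hu', if_pos h₀,
    if_neg (by rw [hc, if_pos rfl]; exact hv), zero_add, add_comm]
  congr 1
  refine Finset.sum_congr rfl fun x hx => ?_
  rw [hc, if_neg (Finset.ne_of_mem_erase hx)]

variable {g : GraphAccess} {ω : Tape} {M n q k : ℕ} {off smp : ℕ → ℕ} {G : SimpleGraph (Fin n)}

theorem scanProg_run {ε : Env} {a u : Fin n} {h hi : ℕ} (hnM : n < M) (hoM : off n ≤ M)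
    (hoff : Monotone off)
    (hs : ∀ (u : Fin n) (s : ℕ), off u ≤ s → s < off (u + 1) → ∃ w : Fin n, smp s = w ∧ G.Adj u w)
    (hF : Fixed n q off smp ε) (ha : ε.reg 10 = a) (hh : ε.reg 11 = h) (hhi : ε.reg 12 = hi)
    (hu : ε.reg 14 = u) (hq : ε.arr 4 0 h = u) (hs₀ : ε.reg 7 = off u)
    (H : Growing G k q off smp a (ε.arr 2 0) (ε.arr 3) (ε.arr 4 0) (h + 1) hi (ε.reg 13) u
      (off u)) :
    Stmt.Run g ω M scanProg ε fun N ε' => N ≤ 7 * (off (u + 1) - off u) + 1 ∧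
      Fixed n q off smp ε' ∧ ε'.reg 10 = a ∧ ε'.reg 11 = h ∧ ε'.reg 12 = hi ∧
      (∀ v, ε'.arr 2 0 v = ε.arr 2 0 v) ∧
      Growing G k q off smp a (ε'.arr 2 0) (ε'.arr 3) (ε'.arr 4 0) (h + 1) hi (ε'.reg 13) n 0 := by
  refine .loop
    (fun ε' => Fixed n q off smp ε' ∧ ε'.reg 10 = a ∧ ε'.reg 11 = h ∧ ε'.reg 12 = hi ∧
      ε'.reg 14 = u ∧ ε'.arr 4 0 h = u ∧ (∀ v, ε'.arr 2 0 v = ε.arr 2 0 v) ∧ off u ≤ ε'.reg 7 ∧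
      Growing G k q off smp a (ε'.arr 2 0) (ε'.arr 3) (ε'.arr 4 0) (h + 1) hi (ε'.reg 13)
        (ε'.arr 4 0 h) (ε'.reg 7))
    (fun ε' => 7 * (off (u + 1) - ε'.reg 7)) ?_ ?_ ?_
  · refine ⟨hF, ha, hh, hhi, hu, hq, fun _ => rfl, hs₀.ge, ?_⟩
    rw [hq, hs₀]
    exact H
  · rintro ε₁ ⟨i₀, i₁, i₂, i₃, i₄, i₅, i₆, i₇, i₈⟩ hc
    simp only [Ex.eval_sub, Ex.eval_arr, Ex.eval_add, Ex.eval_var, Ex.eval_zero, Ex.eval_one, i₄,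
      i₀.start (u + 1) u.2] at hc
    obtain ⟨w, hw, hG⟩ := hs u (ε₁.reg 7) i₇ (by omega)
    have hle := hoff (show (u : ℕ) + 1 ≤ n from u.2)
    have hu2 := u.2
    have hw2 := w.2
    have htail := i₈.tail_le
    refine .seq (.assign (by simp [i₀.sample, hw]; omega) (.seq (.ite ?_ ?_)))
    · intro hne
      refine .skip (.assign (by simp; omega) ?_)
      simp [i₁, i₀.sample] at hne
      refine ⟨⟨⟨i₀.nodes, i₀.factor, i₀.start, i₀.sample⟩, i₁, i₂, i₃, i₄, i₅, i₆, ?_, ?_⟩, ?_⟩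
      · simp; omega
      · refine i₈.skip ?_ ?_
        · simp; omega
        · omega
      · simp; omega
    · intro he
      simp [i₁, i₀.sample] at he
      refine .seq (.store (by simp [i₄]; omega) (.seq (.store (by simp [i₀.sample]; omega)
        (.assign (by simp; omega) (.assign (by simp; omega) ?_)))))
      refine ⟨⟨⟨i₀.nodes, i₀.factor, ?_, ?_⟩, i₁, i₂, i₃, i₄, ?_, ?_, ?_, ?_⟩, ?_⟩
      · simpa using i₀.start
      · simpa using i₀.sample
      · have := i₈.h_le
        have := i₈.hi_le
        simp
        rw [if_neg (by omega), i₅]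
      · simpa using i₆
      · simp; omega
      · refine i₈.push (by omega) i₅ hw hG (fun l x => ?_) fun j => ?_
        · simp [i₁, i₄, i₅, i₀.sample]
        · simp [i₀.sample]
      · simp; omega
  · rintro N ε₁ ⟨i₀, i₁, i₂, i₃, i₄, i₅, i₆, i₇, i₈⟩ hc hN
    simp only [Ex.eval_sub, Ex.eval_arr, Ex.eval_add, Ex.eval_var, Ex.eval_zero, Ex.eval_one, i₄,
      i₀.start (u + 1) u.2] at hc
    rw [hs₀] at hN
    exact ⟨by omega, i₀, i₁, i₂, i₃, i₆, i₈.close (by rw [i₅]; omega)⟩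

/-- Every round of the loop labels one node and is paid from `unscanned`. The loop invariant adds
that a fully scanned layer is final only if the ball is small, which is what `Growing.finish` needs
at the exit. -/
theorem ballProg_run {ε : Env} {a : Fin n} (hnM : n < M) (hoM : off n ≤ M) (hoff : Monotone off)
    (hs : ∀ (u : Fin n) (s : ℕ), off u ≤ s → s < off (u + 1) → ∃ w : Fin n, smp s = w ∧ G.Adj u w)
    (hk : 1 ≤ k) (hq : 1 ≤ q) (hnq : n ≤ q ^ k)
    (hF : Fixed n q off smp ε) (ha : ε.reg 10 = a) (hca : ε.arr 2 0 a = 0)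
    (H : Grown G k q off smp a (ε.arr 2 0) (ε.arr 3)) :
    Stmt.Run g ω M ballProg ε fun N ε' =>
      N + unscanned n off (ε'.arr 2 0) ≤ unscanned n off (ε.arr 2 0) + 6 ∧
      Fixed n q off smp ε' ∧ ε'.reg 10 = a ∧
      Grown G k q off smp (a + 1) (ε'.arr 2 0) (ε'.arr 3) := by
  have ha2 := a.2
  refine .seq (.store (by simp [ha]; omega) (.seq (.store (by simp [ha]; omega)
    (.seq (.assign (by simp) (.seq (.assign (by simp; omega) (.seq (.assign (by simp; omega)
    (.loop
    (fun ε' => Fixed n q off smp ε' ∧ ε'.reg 10 = a ∧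
      Growing G k q off smp a (ε'.arr 2 0) (ε'.arr 3) (ε'.arr 4 0) (ε'.reg 11) (ε'.reg 12)
        (ε'.reg 13) n 0 ∧ (ε'.reg 11 = ε'.reg 12 → ε'.reg 13 ≤ q * ε'.reg 12))
    (fun ε' => unscanned n off (ε'.arr 2 0)) ?_ ?_ ?_))))))))))
  · refine ⟨⟨hF.nodes, hF.factor, ?_, ?_⟩, ha, H.start hk ?_ ?_ ?_, by simp⟩
    · simpa using hF.start
    · simpa using hF.sample
    · simpa using hca
    · simp [ha]
    · intro l w
      simp [ha]
  · rintro ε₁ ⟨i₀, i₁, i₂, i₃⟩ hc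
    simp only [Ex.eval_sub, Ex.eval_var] at hc
    have hlt : ε₁.reg 11 < ε₁.reg 12 := by omega
    have hht := hlt.trans_le i₂.hi_le
    obtain ⟨u, hu⟩ : ∃ u : Fin n, ε₁.arr 4 0 (ε₁.reg 11) = u := ⟨⟨_, i₂.que_lt _ hht⟩, rfl⟩
    have hu2 := u.2
    have h₀ := i₂.unlab _ le_rfl hht
    have hle := hoff (show (u : ℕ) ≤ n from u.2.le)
    have hlab : ∀ c', (∀ v, c' v = if v = (u : ℕ) then (a : ℕ) + 1 else ε₁.arr 2 0 v) →
        unscanned n off (ε₁.arr 2 0) =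
          unscanned n off c' + (12 + 10 * (off (u + 1) - off u)) :=
      fun c' hc' => unscanned_label u.2 (by rw [← hu, h₀]) (Nat.succ_ne_zero _) hc'
    refine .seq (.assign (by simp [hu]; omega) (.seq (.store (by simp [i₁]; omega)
      (.seq (.assign (by simp [hu, i₀.start u u.2.le]; omega) ?_)))))
    refine .seq ((scanProg_run (k := k) (q := q) (a := a) (h := ε₁.reg 11) (hi := ε₁.reg 12) (u := u) hnM hoM hoff hs
      ⟨?_, ?_, ?_, ?_⟩ ?_ ?_ ?_ ?_ ?_ ?_ ?_).mono ?_)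
    · simpa using i₀.nodes
    · simpa using i₀.factor
    · simpa using i₀.start
    · simpa using i₀.sample
    · simpa using i₁
    · simp
    · simp
    · simpa using hu
    · simpa using hu
    · simp [hu, i₀.start u u.2.le]
    · have := i₂.label hlt (c' := fun v => if v = (u : ℕ) then (a : ℕ) + 1 else ε₁.arr 2 0 v)
        (by simp [hu])
      rw [hu] at this
      simpa [hu, i₁, Env.put, Env.set] using this
    · rintro N ε₂ ⟨hN, j₀, j₁, j₂, j₃, j₄, j₅⟩
      have hu' := hlab (ε₂.arr 2 0) fun v => by rw [j₄]; simp [hu, i₁]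
      have htail := j₅.tail_le
      have hh := j₅.h_le
      have hhi := j₅.hi_le
      refine .seq (.assign (by simp [j₂]; omega) (.ite (fun h => .skip ?_) fun h => .ite ?_ ?_))
      · simp [j₂, j₃] at h
        refine ⟨⟨⟨j₀.nodes, j₀.factor, j₀.start, j₀.sample⟩, j₁, ?_, ?_⟩, ?_⟩
        · simpa [j₂, j₃] using j₅
        · simp [j₂, j₃]; omega
        · simp; omega
      · intro h'
        simp [j₂, j₃] at h
        simp [j₃, j₀.factor] at h'
        refine .assign (by simp; omega) ?_
        refine ⟨⟨⟨j₀.nodes, j₀.factor, j₀.start, j₀.sample⟩, j₁, ?_, ?_⟩, ?_⟩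
        · simpa [j₂, j₃] using j₅.layer hq hnq (by omega) (by omega)
        · simpa using fun _ => Nat.le_mul_of_pos_left _ hq
        · simp; omega
      · intro h'
        simp [j₂, j₃] at h
        simp [j₃, j₀.factor] at h'
        refine .skip ⟨⟨⟨j₀.nodes, j₀.factor, j₀.start, j₀.sample⟩, j₁, ?_, ?_⟩, ?_⟩
        · simpa [j₂, j₃] using j₅
        · simp [j₃]; omega
        · simp; omega
  · rintro N ε₁ ⟨i₀, i₁, i₂, i₃⟩ hc hN
    simp only [Ex.eval_sub, Ex.eval_var] at hc
    have hh := i₂.h_le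
    have heq : ε₁.reg 11 = ε₁.reg 12 := by omega
    refine ⟨?_, i₀, i₁, i₂.finish heq (i₃ heq)⟩
    have := hN.trans_eq (congrArg (· + 1) (congrArg (unscanned n off)
      (funext fun v => show _ = ε.arr 2 0 v by simp)))
    omega

theorem growProg_run {ε : Env} (hnM : n < M) (hoM : off n ≤ M) (hoff : Monotone off)
    (hs : ∀ (u : Fin n) (s : ℕ), off u ≤ s → s < off (u + 1) → ∃ w : Fin n, smp s = w ∧ G.Adj u w)
    (hk : 1 ≤ k) (hq : 1 ≤ q) (hnq : n ≤ q ^ k)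
    (hF : Fixed n q off smp ε) (h₂ : ∀ a b, ε.arr 2 a b = 0) (h₃ : ∀ a b, ε.arr 3 a b = 0) :
    Stmt.Run g ω M growProg ε fun N ε' =>
      N ≤ unscanned n off (fun _ => 0) + 10 * n + 2 ∧
      Grown G k q off smp n (ε'.arr 2 0) (ε'.arr 3) := by
  refine .seq (.assign (by simp) (.loop
    (fun ε' => Fixed n q off smp ε' ∧ ε'.reg 10 ≤ n ∧
      Grown G k q off smp (ε'.reg 10) (ε'.arr 2 0) (ε'.arr 3))
    -- Ten units per centre cover the initialisation of its ball, the branch, the increment and the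
    -- loop test.
    (fun ε' => unscanned n off (ε'.arr 2 0) + 10 * (n - ε'.reg 10)) ?_ ?_ ?_))
  · exact ⟨⟨hF.nodes, hF.factor, hF.start, hF.sample⟩, by simp, .init (by simp [h₂]) (by simp [h₃])⟩
  · rintro ε₁ ⟨i₀, i₁, i₂⟩ hc
    simp only [Ex.eval_sub, Ex.eval_var, i₀.nodes] at hc
    obtain ⟨a, ha⟩ : ∃ a : Fin n, ε₁.reg 10 = a := ⟨⟨ε₁.reg 10, by omega⟩, rfl⟩
    rw [ha] at i₂ hc
    refine .seq (.ite (fun h => .skip (.assign (by simp [ha]; omega) ?_))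
      fun h => (ballProg_run hnM hoM hoff hs hk hq hnq i₀ ha (by simpa [ha] using h) i₂).mono ?_)
    · refine ⟨⟨⟨i₀.nodes, i₀.factor, i₀.start, i₀.sample⟩, ?_, ?_⟩, ?_⟩
      · simp [ha]
      · simpa [ha] using i₂.skip hk (by simpa [ha] using h)
      · simp [ha]; omega
    · rintro N ε₂ ⟨hN, j₀, j₁, j₂⟩
      refine .assign (by simp [j₁]; omega)
        ⟨⟨⟨j₀.nodes, j₀.factor, j₀.start, j₀.sample⟩, ?_, ?_⟩, ?_⟩
      · simp [j₁]
      · simpa [j₁] using j₂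
      · simp [j₁, ha]; omega
  · rintro N ε₁ ⟨i₀, i₁, i₂⟩ hc hN
    simp only [Ex.eval_sub, Ex.eval_var, i₀.nodes] at hc
    have heq : ε₁.reg 10 = n := by omega
    rw [heq] at i₂
    refine ⟨?_, i₂⟩
    have : (ε.set 10 0).arr 2 0 = fun _ => 0 := funext fun v => h₂ 0 v
    simp only [Env.set_arr, Ex.eval_zero] at this hN
    rw [this] at hN
    simp at hN
    omega

end RAM

/-! ### The spanner -/

section Spanner

variable {n : ℕ}

/-- The tree edges and the edges that are in no ball. -/
def spannerGraph (G : SimpleGraph (Fin n)) (c : ℕ → ℕ) (P : ℕ → ℕ → ℕ) : SimpleGraph (Fin n) where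
  Adj u w := G.Adj u w ∧
    ((P (c u) w = 0 ∧ P (c w) u = 0) ∨ P (c u) w = u + 1 ∨ P (c w) u = w + 1)
  symm := ⟨fun u w h => ⟨h.1.symm, by tauto⟩⟩
  loopless := ⟨fun u h => G.loopless.irrefl u h.1⟩

/-- The pairs `(u, w)` of adjacent nodes such that `w` was labelled after `u`, but is not in the
ball of `u`. -/
noncomputable def uncovered (G : SimpleGraph (Fin n)) (c : ℕ → ℕ) (P : ℕ → ℕ → ℕ) :
    Finset (Fin n × Fin n) :=
  open Classical in
  Finset.univ.filter fun p => G.Adj p.1 p.2 ∧ c p.1 < c p.2 ∧ P (c p.1) p.2 = 0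

/-- Stretch adds up along a shortest path. Between different components the right side is κ · ∞,
which is infinite only because κ ≠ 0. -/
theorem isSpanner_of_adj {G H : SimpleGraph (Fin n)} {κ : ℕ} (hκ : κ ≠ 0) (hle : H ≤ G)
    (h : ∀ u w, G.Adj u w → H.edist u w ≤ κ) : IsSpanner G H κ := by
  refine ⟨hle, fun s t => ?_⟩
  by_cases hr : G.Reachable s t
  · obtain ⟨p, hp⟩ := hr.exists_walk_length_eq_edist
    rw [← hp]
    clear hp hr
    induction p with
    | nil => simp
    | @cons u v w huv p ih =>
      calc H.edist u w ≤ H.edist u v + H.edist v w := SimpleGraph.edist_triangle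
        _ ≤ κ + κ * (p.length : ℕ∞) := add_le_add (h u v huv) ih
        _ = κ * ((SimpleGraph.Walk.cons huv p).length : ℕ∞) := by
          rw [SimpleGraph.Walk.length_cons]
          push_cast
          ring
  · rw [SimpleGraph.edist_eq_top_of_not_reachable hr, ENat.mul_top]
    · exact le_top
    · exact_mod_cast hκ

variable {G : SimpleGraph (Fin n)} {k q : ℕ} {off smp c : ℕ → ℕ} {P : ℕ → ℕ → ℕ}

theorem treeGraph_le_spannerGraph (H : Grown G k q off smp n c P) :
    treeGraph n c P ≤ spannerGraph G c P := by
  have key : ∀ u w : Fin n, u ≠ w → P (c u) w = u + 1 → G.Adj u w := fun u w hne h => by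
    rcases H.forest.edge _ _ _ h with h' | ⟨_, h'⟩
    · exact absurd (Fin.ext h') hne
    · exact h'
  intro u w h
  rw [treeGraph, SimpleGraph.fromRel_adj] at h
  rcases h.2 with h' | h'
  · exact ⟨key u w h.1 h', Or.inr (Or.inl h')⟩
  · exact ⟨(key w u h.1.symm h').symm, Or.inr (Or.inr h')⟩

/-- If `w` is in the ball of the cluster of `u`, the walk through its root has length at most i + (i
+ 1) ≤ 2k - 1. It matters that the same i bounds both radii. An edge in no ball is kept. -/
theorem Grown.isSpanner (hk : 1 ≤ k) (H : Grown G k q off smp n c P) :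
    IsSpanner G (spannerGraph G c P) (2 * k - 1) := by
  have key : ∀ u w : Fin n, P (c u) w ≠ 0 →
      (spannerGraph G c P).edist u w ≤ (2 * k - 1 : ℕ) := by
    intro u w h
    obtain ⟨-, h₁, h₂⟩ := H.forest.supp _ _ h
    obtain ⟨z, i, hi, hu, hw⟩ := H.radius _ h₁ h₂
    calc (spannerGraph G c P).edist u w ≤ (treeGraph n c P).edist u w :=
          SimpleGraph.edist_anti (treeGraph_le_spannerGraph H)
      _ ≤ (treeGraph n c P).edist u z + (treeGraph n c P).edist z w := SimpleGraph.edist_triangle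
      _ ≤ (i : ℕ∞) + (i + 1 : ℕ) :=
          add_le_add (SimpleGraph.edist_comm.trans_le (hu u rfl)) (hw w h)
      _ ≤ (2 * k - 1 : ℕ) := by
          rw [← Nat.cast_add, Nat.cast_le]
          omega
  refine isSpanner_of_adj (by omega) (fun u w h => h.1) fun u w h => ?_
  by_cases h₁ : P (c u) w = 0
  · by_cases h₂ : P (c w) u = 0
    · have : (spannerGraph G c P).Adj u w := ⟨h, Or.inl ⟨h₁, h₂⟩⟩
      rw [SimpleGraph.edist_eq_one_iff_adj.2 this, Nat.one_le_cast]
      omega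
    · exact SimpleGraph.edist_comm.trans_le (key w u h₂)
  · exact key u w h₁

/-- A ball entry stores only one parent, so tree edges are at most as many as entries. Any other
kept edge, oriented towards the larger label, is an uncovered pair. -/
theorem Grown.ncard_edgeSet_le (H : Grown G k q off smp n c P) :
    (spannerGraph G c P).edgeSet.ncard ≤ q * n + (uncovered G c P).card := by
  classical
  let T : Finset (Fin n × Fin n) := Finset.univ.filter fun p => P (c p.1) p.2 = p.1 + 1
  have hT : T.card ≤ entries n P := by
    refine Finset.card_le_card_of_injOn (fun p => (c p.1, (p.2 : ℕ))) ?_ ?_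
    · rintro ⟨u, w⟩ h
      simp only [T, Finset.coe_filter, Finset.mem_univ, true_and, Set.mem_ofPred_eq] at h
      have := H.forest.lab_le u u.2
      simp [h]
      omega
    · rintro ⟨u, w⟩ h ⟨u', w'⟩ h' heq
      simp only [T, Finset.coe_filter, Finset.mem_univ, true_and, Set.mem_ofPred_eq] at h h'
      simp only [Prod.mk.injEq] at heq ⊢
      have hw : w = w' := Fin.ext heq.2
      subst hw
      rw [heq.1, h'] at h
      exact ⟨Fin.ext (by omega), rfl⟩
  have hsub : (spannerGraph G c P).edgeSet ⊆
      ((T ∪ uncovered G c P).image fun p => s(p.1, p.2) : Finset (Sym2 (Fin n))) := by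
    intro e
    induction e with
    | _ u w =>
    intro h
    rw [SimpleGraph.mem_edgeSet] at h
    simp only [Finset.coe_image, Set.mem_image, Finset.mem_coe, Finset.mem_union, T, uncovered,
      Finset.mem_filter, Finset.mem_univ, true_and]
    rcases h with ⟨hG, ⟨h₁, h₂⟩ | h₁ | h₁⟩
    · rcases lt_trichotomy (c u) (c w) with hlt | heq | hlt
      · exact ⟨(u, w), Or.inr ⟨hG, hlt, h₁⟩, rfl⟩
      -- Equal labels cannot occur: `w` lies in the ball of its own label, which is also that of
      -- `u`.
      · rw [heq] at h₁
        exact absurd h₁ (H.forest.self w w.2 (H.done w w.2))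
      · exact ⟨(w, u), Or.inr ⟨hG.symm, hlt, h₂⟩, Sym2.eq_swap⟩
    · exact ⟨(u, w), Or.inl h₁, rfl⟩
    · exact ⟨(w, u), Or.inl h₁, Sym2.eq_swap⟩
  have hlab : labelled n c ≤ n := (Finset.card_filter_le _ _).trans (Finset.card_range n).le
  calc _ ≤ ((T ∪ uncovered G c P).image fun p => s(p.1, p.2)).card := by
        rw [← Set.ncard_coe_finset]
        exact Set.ncard_le_ncard hsub
    _ ≤ (T ∪ uncovered G c P).card := Finset.card_image_le
    _ ≤ T.card + (uncovered G c P).card := Finset.card_union_le _ _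
    _ ≤ q * n + (uncovered G c P).card :=
        Nat.add_le_add_right ((hT.trans H.count).trans (Nat.mul_le_mul_left q hlab)) _

/-- No sample hits an uncovered pair. -/
theorem Grown.sample_ne (H : Grown G k q off smp n c P) {u w : Fin n}
    (h : (u, w) ∈ uncovered G c P) {s : ℕ} (h₁ : off u ≤ s) (h₂ : s < off (u + 1)) :
    smp s ≠ w := by
  simp only [uncovered, Finset.mem_filter, Finset.mem_univ, true_and] at h
  intro hs
  rcases H.cov u u.2 (H.done u u.2) s h₁ h₂ with h' | h' <;> rw [hs] at h'
  · omega
  · exact h' h.2.2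

end Spanner

namespace RAM

/-! ### The query program -/

/-- The parent of the node in variable `y` in the ball of the node in variable `x`. -/
def parentEx (x y : Fin 16) : Ex := .arr 3 (.arr 2 0 (.var x)) (.var y)

def eqEx (e f : Ex) : Ex := 1 - ((e - f) + (f - e))

/-- Boolean logic in truncated arithmetic: sums are disjunctions, products conjunctions, `1 - x` is
negation, and the double negation turns any nonzero value into 1. -/
def queryProg : Stmt :=
  .assign 0 (1 - (1 - .adj (.var 0) (.var 1) *
    ((1 - (parentEx 0 1 + parentEx 1 0)) +
      (eqEx (parentEx 0 1) (.var 0 + 1) + eqEx (parentEx 1 0) (.var 1 + 1)))))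

theorem queryProg_isQuery : queryProg.code.IsQuery := by
  trivial

/-- The initial state of a while program. -/
def Env.start (inputs : List ℕ) (arr : ℕ → ℕ → ℕ → ℕ) : Env where
  reg x := inputs.getD x 0
  arr := arr
  draws := 0

theorem Rep.start (inputs : List ℕ) {arr : ℕ → ℕ → ℕ → ℕ} {m : ℕ → ℕ}
    (h : ∀ j a b, m (cell j a b) = arr j a b) :
    Rep (Env.start inputs arr) (State.start inputs m) :=
  ⟨fun _ => rfl, h, rfl⟩

open Classical in
theorem queryProg_exec {n M : ℕ} {G : SimpleGraph (Fin n)} (L : AdjList G) (hM : 1 ≤ M) (ω : Tape)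
    (arr : ℕ → ℕ → ℕ → ℕ) (u v : Fin n) : ∃ ε',
      Stmt.Exec (GraphAccess.ofGraph G L) ω M queryProg (Env.start [u, v] arr) 1 ε' ∧
      ε'.reg 0 = if (spannerGraph G (arr 2 0) (arr 3)).Adj u v then 1 else 0 := by
  refine ⟨_, .assign _ _ _ ?_, ?_⟩
  · rw [Ex.eval_sub, Ex.eval_one]
    omega
  · have hadj : (GraphAccess.ofGraph G L).adj u v = if G.Adj u v then 1 else 0 := by
      simp [GraphAccess.ofGraph]
    simp only [Env.set_reg, if_true, parentEx, eqEx, Ex.eval_sub, Ex.eval_add, Ex.eval_mul,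
      Ex.eval_one, Ex.eval_zero, Ex.eval_adj, Ex.eval_arr, Ex.eval_var, Env.start]
    simp only [show ((0 : Fin 16) : ℕ) = 0 from rfl, show ((1 : Fin 16) : ℕ) = 1 from rfl,
      List.getD_cons_zero, List.getD_cons_succ, hadj, spannerGraph]
    by_cases hG : G.Adj u v
    · simp only [hG, if_true, true_and, one_mul]
      split_ifs with h <;> omega
    · simp [hG]

end RAM

namespace RAM

/-! ### The preprocessing program: correctness and cost -/

variable {n : ℕ} {G : SimpleGraph (Fin n)}

theorem adjList_length_le (L : AdjList G) (v : Fin n) : (L.nbrs v).length ≤ n := by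
  simpa using (L.nodup v).length_le_card

theorem GraphAccess.ofGraph_deg (L : AdjList G) (v : Fin n) :
    (GraphAccess.ofGraph G L).deg v = (L.nbrs v).length := by
  simp [GraphAccess.ofGraph]

theorem GraphAccess.ofGraph_nbr (L : AdjList G) (v : Fin n) (i : ℕ)
    (hi : i < (L.nbrs v).length) : (GraphAccess.ofGraph G L).nbr v i = (L.nbrs v)[i] := by
  simp [GraphAccess.ofGraph, hi]

theorem GraphAccess.ofGraph_bdd (hn : 1 ≤ n) (L : AdjList G) :
    (GraphAccess.ofGraph G L).Bdd n where
  deg v := by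
    simp only [GraphAccess.ofGraph]
    split_ifs
    · exact adjList_length_le L _
    · omega
  nbr v i := by
    simp only [GraphAccess.ofGraph]
    split_ifs
    · cases (L.nbrs ⟨v, _⟩)[i]? with
      | none => simp
      | some w => exact w.2.le
    · omega
  adj u v := by
    simp only [GraphAccess.ofGraph]
    split_ifs <;> omega

theorem GraphAccess.Bdd.mono {g : GraphAccess} {M M' : ℕ} (h : g.Bdd M) (hM : M ≤ M') :
    g.Bdd M' :=
  ⟨fun v => (h.deg v).trans hM, fun v i => (h.nbr v i).trans hM, fun u v => (h.adj u v).trans hM⟩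

theorem Tape.draw_lt (ω : Tape) {t b : ℕ} (hb : b ≠ 0) : ω.draw t b < b := by
  rw [Tape.draw, if_neg hb]
  have := (ω (t, b - 1)).2
  omega

theorem unscanned_zero (g : GraphAccess) (n r : ℕ) :
    unscanned n (sampleStart g r) (fun _ => 0) = 12 * n + 10 * sampleStart g r n := by
  simp only [unscanned, if_true, sampleStart_succ, Nat.add_sub_cancel_left,
    Finset.sum_add_distrib, ← Finset.mul_sum, Finset.sum_const, Finset.card_range, smul_eq_mul]
  rw [mul_comm, sampleStart]

theorem sampleCount_eq_zero {g : GraphAccess} {r v : ℕ} (hr : 1 ≤ r) (h : g.deg v = 0) :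
    sampleCount g r v = 0 := by
  rw [sampleCount, h]
  exact Nat.div_eq_of_lt (by omega)

/-- A bound for all numbers that occur in a run of the preprocessing program. -/
def numBound (g : GraphAccess) (n k r : ℕ) : ℕ := n ^ k + k + n + sampleStart g r n + 2

/-- Everything here holds for each tape separately; the tape enters only through the sampled
neighbours `smp`. -/
theorem preProg_exec (hn : 1 ≤ n) (L : AdjList G) {k r : ℕ} (hk : 1 ≤ k) (hr : 1 ≤ r) (hrn : r ≤ n)
    (ω : Tape) : ∃ N ε', Stmt.Exec (GraphAccess.ofGraph G L) ω
      (numBound (GraphAccess.ofGraph G L) n k r) preProg (Env.start [n, k, r] fun _ _ _ => 0) N ε' ∧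
      N ≤ n * (3 * k + 33) + 15 * sampleStart (GraphAccess.ofGraph G L) r n + 7 ∧
      ε'.Bdd (numBound (GraphAccess.ofGraph G L) n k r) ∧
      ∃ (q : ℕ) (smp : ℕ → ℕ), (q - 1) ^ k < n ∧
        Grown G k q (sampleStart (GraphAccess.ofGraph G L) r) smp n (ε'.arr 2 0) (ε'.arr 3) ∧
        ∀ v < n, ∀ s, sampleStart (GraphAccess.ofGraph G L) r v ≤ s →
          s < sampleStart (GraphAccess.ofGraph G L) r (v + 1) →
          smp s = (GraphAccess.ofGraph G L).nbr v (ω.draw s ((GraphAccess.ofGraph G L).deg v)) := by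
  obtain ⟨g, hgdef⟩ : ∃ g, g = GraphAccess.ofGraph G L := ⟨_, rfl⟩
  rw [← hgdef]
  obtain ⟨M, hMdef⟩ : ∃ M, M = numBound g n k r := ⟨_, rfl⟩
  rw [← hMdef]
  have hg : g.Bdd M := hgdef ▸ (GraphAccess.ofGraph_bdd hn L).mono (by rw [hMdef, numBound]; omega)
  have hM := hMdef
  rw [numBound] at hM
  have hstart : (Env.start [n, k, r] fun _ _ _ => 0).Bdd M := by
    refine ⟨fun x => ?_, fun _ _ _ => Nat.zero_le _⟩
    simp only [Env.start]
    rcases x with ⟨_ | _ | _ | x, hx⟩ <;> simp <;> omega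
  have run : Stmt.Run g ω M preProg (Env.start [n, k, r] fun _ _ _ => 0) fun N ε' =>
      N ≤ n * (3 * k + 33) + 15 * sampleStart g r n + 7 ∧
      ∃ (q : ℕ) (smp : ℕ → ℕ), (q - 1) ^ k < n ∧
        Grown G k q (sampleStart g r) smp n (ε'.arr 2 0) (ε'.arr 3) ∧
        ∀ v < n, ∀ s, sampleStart g r v ≤ s → s < sampleStart g r (v + 1) →
          smp s = g.nbr v (ω.draw s (g.deg v)) := by
    refine .seq ((rootProg_run hn hk (by omega) (by omega) (by omega) rfl rfl rfl rfl).mono ?_)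
    rintro N₁ ε₁ ⟨b₁, i₀, -, i₂, iA, iD, q₁, q₂, q₃⟩
    refine .seq ((sampleProg_run (n := n) (r := r) hg (by omega) (by omega) i₀ (by rw [i₂]; rfl)
      (by rw [iD]; rfl) (by rw [iA]; intros; rfl)).mono ?_)
    rintro N₂ ε₂ ⟨b₂, j₀, j₃, jo, js, j2, j3⟩
    refine (growProg_run (G := G) (k := k) (q := ε₁.reg 3) (off := sampleStart g r)
      (smp := ε₂.arr 1 0) (by omega) (by omega) (sampleStart_mono g r) ?_ hk q₁ q₂
      ⟨j₀, j₃, jo, fun _ => rfl⟩ j2 j3).mono ?_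
    · intro u s h₁ h₂
      -- A node with a sample has positive degree, so the draw is a valid position in its list and
      -- yields a true neighbour.
      have hd : g.deg u ≠ 0 := fun h => by
        have := sampleStart_succ g r u
        have := sampleCount_eq_zero (g := g) hr h
        omega
      have hlt := ω.draw_lt (t := s) hd
      rw [js u u.2 s h₁ h₂]
      subst hgdef
      rw [GraphAccess.ofGraph_deg] at hlt ⊢
      exact ⟨_, GraphAccess.ofGraph_nbr L u _ hlt, (L.mem_iff _ _).1 (List.getElem_mem _)⟩
    · rintro N₃ ε₃ ⟨b₃, hG⟩
      rw [unscanned_zero] at b₃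
      refine ⟨?_, _, _, q₃, hG, js⟩
      have e₁ : n * (3 * k + 33) = n * (3 * k + 5) + 28 * n := by ring
      omega
  obtain ⟨N, ε', h₁, h₂, h₃⟩ := run
  exact ⟨N, ε', h₁, h₂, h₁.bdd hstart, h₃⟩

/-! ### The probability that the samples avoid a set -/

/-- No sample of a node `u` is a node `w` with `(u, w) ∈ U`. -/
def Avoids (g : GraphAccess) (r : ℕ) (U : Finset (Fin n × Fin n)) (ω : Tape) : Prop :=
  ∀ u w : Fin n, (u, w) ∈ U → ∀ s, sampleStart g r u ≤ s → s < sampleStart g r (u + 1) →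
    g.nbr u (ω.draw s (g.deg u)) ≠ w

/-- Every element of `W` occurs in the list of `u`, so at least |W| of the deg u positions are hits;
then 1 - x ≤ exp(-x). -/
theorem uniform_avoid_le (L : AdjList G) (u : Fin n) (W : Finset (Fin n)) (hW : ∀ w ∈ W, G.Adj u w)
    {b : ℕ} (hb : (GraphAccess.ofGraph G L).deg u = b + 1) :
    (PMF.uniformOfFintype (Fin (b + 1))).toMeasure.real
      {x | ∀ w ∈ W, (GraphAccess.ofGraph G L).nbr u x ≠ w} ≤
      Real.exp (-(W.card / (GraphAccess.ofGraph G L).deg u : ℝ)) := by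
  classical
  obtain ⟨A, hA⟩ : ∃ A : Finset (Fin (b + 1)), A = Finset.univ.filter fun x : Fin (b + 1) =>
    ∃ w ∈ W, (GraphAccess.ofGraph G L).nbr u x = w := ⟨_, rfl⟩
  have hcard : W.card ≤ A.card := by
    have : W.image Fin.val ⊆ A.image fun x : Fin (b + 1) =>
        (GraphAccess.ofGraph G L).nbr u x := by
      intro w' hw'
      obtain ⟨w, hw, rfl⟩ := Finset.mem_image.1 hw'
      obtain ⟨i, hi, hi'⟩ := List.getElem_of_mem ((L.mem_iff u w).2 (hW w hw))
      have hib : i < b + 1 := by rwa [← hb, GraphAccess.ofGraph_deg]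
      have h : (GraphAccess.ofGraph G L).nbr u i = w := by
        rw [GraphAccess.ofGraph_nbr L u i hi, hi']
      refine Finset.mem_image.2 ⟨⟨i, hib⟩, ?_, h⟩
      rw [hA]
      exact Finset.mem_filter.2 ⟨Finset.mem_univ _, w, hw, h⟩
    have h := (Finset.card_le_card this).trans Finset.card_image_le
    rwa [Finset.card_image_of_injective _ Fin.val_injective] at h
  have hset : {x : Fin (b + 1) | ∀ w ∈ W, (GraphAccess.ofGraph G L).nbr u x ≠ w} =
      ((Aᶜ : Finset _) : Set (Fin (b + 1))) := by
    ext x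
    simp [hA]
  have hpos : (0 : ℝ) < (b + 1 : ℕ) := by positivity
  have hAb : A.card ≤ b + 1 := by simpa using A.card_le_univ
  have hcompl : Fintype.card ((Aᶜ : Finset (Fin (b + 1))) : Set (Fin (b + 1))) =
      b + 1 - A.card := by
    rw [← Set.toFinset_card]
    simp [Finset.card_compl]
  rw [hset, hb, measureReal_def,
    PMF.toMeasure_uniformOfFintype_apply _ (Set.toFinite _).measurableSet, hcompl,
    Fintype.card_fin, ENNReal.toReal_div, ENNReal.toReal_natCast, ENNReal.toReal_natCast,
    Nat.cast_sub hAb]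
  calc (((b + 1 : ℕ) : ℝ) - A.card) / (b + 1 : ℕ) = 1 - A.card / (b + 1 : ℕ) := by
        rw [sub_div, div_self hpos.ne']
    _ ≤ 1 - W.card / (b + 1 : ℕ) := by gcongr
    _ ≤ _ := by
      have := Real.add_one_le_exp (-(W.card / (b + 1 : ℕ) : ℝ))
      linarith

/-- Different samples read different coordinates of the tape, so the probability is at most a
product. Node u contributes at least deg u / r factors, each at most exp(-|W u| / deg u), hence at
most exp(-|W u| / r). -/
theorem avoids_le (L : AdjList G) {r : ℕ} (hr : 1 ≤ r) (U : Finset (Fin n × Fin n))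
    (hU : ∀ p ∈ U, G.Adj p.1 p.2) :
    tapeMeasure.real {ω | Avoids (GraphAccess.ofGraph G L) r U ω} ≤
      Real.exp (-(U.card / r : ℝ)) := by
  classical
  obtain ⟨g, hg⟩ : ∃ g, g = GraphAccess.ofGraph G L := ⟨_, rfl⟩
  rw [← hg]
  let W : Fin n → Finset (Fin n) := fun u => Finset.univ.filter fun w => (u, w) ∈ U
  have hW : ∀ u w, w ∈ W u ↔ (u, w) ∈ U := fun u w => by simp [W]
  have hmono := sampleStart_mono g r
  let I : Finset (Σ _ : Fin n, ℕ) :=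
    Finset.univ.sigma fun u => Finset.Ico (sampleStart g r u) (sampleStart g r (u + 1))
  -- The tape coordinate read by a sample: its number, and the range of the draw minus one.
  let f : (Σ _ : Fin n, ℕ) → ℕ × ℕ := fun p => (p.2, g.deg p.1 - 1)
  -- A coordinate does not name the node, so the condition quantifies over all nodes owning this
  -- sample number; there is only one, as the intervals are disjoint.
  let t : (i : ℕ × ℕ) → Set (Fin (i.2 + 1)) := fun i => {x | ∀ u : Fin n,
    sampleStart g r u ≤ i.1 → i.1 < sampleStart g r (u + 1) → i.2 = g.deg u - 1 →
      ∀ w ∈ W u, g.nbr u x ≠ w}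
  have hdeg : ∀ (u : Fin n) (s : ℕ), sampleStart g r u ≤ s → s < sampleStart g r (u + 1) →
      g.deg u ≠ 0 := fun u s h₁ h₂ h => by
    have := sampleStart_succ g r u
    have := sampleCount_eq_zero (g := g) hr h
    omega
  have hinj : Set.InjOn f I := by
    rintro ⟨u, s⟩ h ⟨u', s'⟩ h' heq
    simp only [I, Finset.coe_sigma, Set.mem_sigma_iff, Finset.coe_univ, Set.mem_univ, true_and,
      Finset.coe_Ico, Set.mem_Ico] at h h'
    simp only [f, Prod.mk.injEq] at heq
    obtain ⟨rfl, -⟩ := heq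
    have : u = u' := by
      rcases lt_trichotomy u u' with hlt | heq | hlt
      · have := hmono (show (u : ℕ) + 1 ≤ u' from hlt)
        omega
      · exact heq
      · have := hmono (show (u' : ℕ) + 1 ≤ u from hlt)
        omega
    rw [this]
  have hsub : {ω | Avoids g r U ω} ⊆ Set.pi (I.image f : Finset (ℕ × ℕ)) t := by
    intro ω hω i hi
    obtain ⟨⟨u, s⟩, -, rfl⟩ := Finset.mem_image.1 (Finset.mem_coe.1 hi)
    intro u' h₁ h₂ h₃ w hw
    have := hω u' w ((hW _ _).1 hw) s h₁ h₂
    rw [Tape.draw, if_neg (hdeg u' s h₁ h₂)] at this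
    simp only [f] at h₃ ⊢
    rwa [← h₃] at this
  have hfac : ∀ p ∈ I, (PMF.uniformOfFintype (Fin ((f p).2 + 1))).toMeasure.real (t (f p)) ≤
      Real.exp (-((W p.1).card / g.deg p.1 : ℝ)) := by
    rintro ⟨u, s⟩ hp
    simp only [I, Finset.mem_sigma, Finset.mem_univ, true_and, Finset.mem_Ico] at hp
    have hd := hdeg u s hp.1 hp.2
    subst hg
    have hsub : t (f ⟨u, s⟩) ⊆ {x | ∀ w ∈ W u, (GraphAccess.ofGraph G L).nbr u x ≠ w} :=
      fun x hx => hx u hp.1 hp.2 rfl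
    exact (measureReal_mono hsub).trans (uniform_avoid_le L u (W u)
      (fun w hw => hU _ ((hW u w).1 hw)) (Nat.succ_pred_eq_of_ne_zero hd).symm)
  have hcount : ∀ u : Fin n, (W u).card / r ≤
      sampleCount g r u * ((W u).card / g.deg u : ℝ) := by
    intro u
    have hr' : (0 : ℝ) < r := by exact_mod_cast hr
    rcases Nat.eq_zero_or_pos (g.deg u) with h | h
    -- An isolated node takes no sample, but it has no adjacent pairs to avoid either.
    · have : W u = ∅ := by
        rw [Finset.eq_empty_iff_forall_notMem]
        intro w hw
        rw [hg, GraphAccess.ofGraph_deg, List.length_eq_zero_iff] at h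
        have := (L.mem_iff u w).2 (hU _ ((hW u w).1 hw))
        rw [h] at this
        simp at this
      simp [this]
    · have h₁ : g.deg u ≤ r * sampleCount g r u := by
        have := Nat.div_add_mod (g.deg u + (r - 1)) r
        have := Nat.mod_lt (g.deg u + (r - 1)) hr
        rw [sampleCount]
        omega
      have h₂ : (g.deg u : ℝ) ≤ r * sampleCount g r u := by exact_mod_cast h₁
      have h₃ : (0 : ℝ) < g.deg u := by exact_mod_cast h
      rw [div_le_iff₀ hr']
      calc ((W u).card : ℝ) = g.deg u * ((W u).card / g.deg u) := by field_simp
        _ ≤ r * sampleCount g r u * ((W u).card / g.deg u) := by gcongr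
        _ = _ := by ring
  have hsum : (U.card : ℝ) = ∑ u, ((W u).card : ℝ) := by
    rw [← Nat.cast_sum]
    congr 1
    rw [← Finset.card_sigma]
    refine Finset.card_bij' (fun p _ => ⟨p.1, p.2⟩) (fun p _ => (p.1, p.2)) ?_ ?_ ?_ ?_
    · intro p hp; simpa [hW] using hp
    · intro p hp; simpa [hW] using hp
    · intro p hp; rfl
    · intro p hp; rfl
  calc tapeMeasure.real {ω | Avoids g r U ω}
      ≤ tapeMeasure.real (Set.pi (I.image f : Finset (ℕ × ℕ)) t) := measureReal_mono hsub
    _ = ∏ i ∈ I.image f, (PMF.uniformOfFintype (Fin (i.2 + 1))).toMeasure.real (t i) := by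
        rw [measureReal_def, tapeMeasure,
          Measure.infinitePi_pi _ fun i _ => (Set.toFinite _).measurableSet, ENNReal.toReal_prod]
        rfl
    _ = ∏ p ∈ I, (PMF.uniformOfFintype (Fin ((f p).2 + 1))).toMeasure.real (t (f p)) :=
        Finset.prod_image hinj
    _ ≤ ∏ p ∈ I, Real.exp (-((W p.1).card / g.deg p.1 : ℝ)) :=
        Finset.prod_le_prod (fun _ _ => measureReal_nonneg) hfac
    _ = Real.exp (-∑ u : Fin n, sampleCount g r u * ((W u).card / g.deg u : ℝ)) := by
        rw [← Real.exp_sum, Finset.sum_sigma, ← Finset.sum_neg_distrib]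
        congr 1
        refine Finset.sum_congr rfl fun u _ => ?_
        simp [sampleStart_succ]
    _ ≤ Real.exp (-(U.card / r : ℝ)) := by
        rw [hsum, Finset.sum_div, Real.exp_le_exp, neg_le_neg_iff]
        exact Finset.sum_le_sum fun u _ => hcount u

end RAM

namespace RAM

variable {n : ℕ} {G : SimpleGraph (Fin n)}

/-! ### The number of uncovered pairs -/

/-- The uncovered pairs for given labels, if the balls consist of the pairs in the range of `f`. -/
noncomputable def uncoveredBy {N : ℕ} (G : SimpleGraph (Fin n)) (c : Fin n → Fin (n + 1))
    (f : Fin N → Fin (n + 1) × Fin n) : Finset (Fin n × Fin n) :=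
  open Classical in
  Finset.univ.filter fun p => G.Adj p.1 p.2 ∧ c p.1 < c p.2 ∧ (c p.1, p.2) ∉ Set.range f

/-- The event that many uncovered pairs of a possible result avoid all samples. -/
def badEvent (L : AdjList G) (r N : ℕ) (B : ℝ) : Set Tape :=
  {ω | ∃ (c : Fin n → Fin (n + 1)) (f : Fin N → Fin (n + 1) × Fin n),
    B ≤ (uncoveredBy G c f).card ∧
      Avoids (GraphAccess.ofGraph G L) r (uncoveredBy G c f) ω}

/-- Union bound: (n+1)^n ≤ (n+1)^N labellings times ((n+1)n)^N lists of entries give at most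
(n+1)^(3N) cases. The threshold B is chosen so that exp(-B/r) = (n+1)^(-(3N+d)). -/
theorem badEvent_le (hn : 1 ≤ n) (L : AdjList G) {r N : ℕ} (hr : 1 ≤ r) (hN : n ≤ N) (d : ℕ) :
    tapeMeasure.real (badEvent L r N (r * (3 * N + d) * Real.log (n + 1))) ≤ 1 / (n : ℝ) ^ d := by
  obtain ⟨B, hB⟩ : ∃ B : ℝ, B = r * (3 * N + d) * Real.log (n + 1) := ⟨_, rfl⟩
  rw [← hB]
  have hr' : (0 : ℝ) < r := by exact_mod_cast hr
  have hn' : (0 : ℝ) < n := by exact_mod_cast hn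
  let E : (Fin n → Fin (n + 1)) × (Fin N → Fin (n + 1) × Fin n) → Set Tape := fun p =>
    {ω | B ≤ (uncoveredBy G p.1 p.2).card ∧
      Avoids (GraphAccess.ofGraph G L) r (uncoveredBy G p.1 p.2) ω}
  have hE : ∀ p, tapeMeasure.real (E p) ≤ Real.exp (-(B / r)) := by
    intro p
    by_cases hp : B ≤ (uncoveredBy G p.1 p.2).card
    · calc tapeMeasure.real (E p)
          ≤ tapeMeasure.real
              {ω | Avoids (GraphAccess.ofGraph G L) r (uncoveredBy G p.1 p.2) ω} :=
            measureReal_mono fun ω hω => hω.2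
        _ ≤ Real.exp (-((uncoveredBy G p.1 p.2).card / r : ℝ)) := by
            refine avoids_le L hr _ fun x hx => ?_
            simp only [uncoveredBy, Finset.mem_filter] at hx
            exact hx.2.1
        _ ≤ Real.exp (-(B / r)) := by
            rw [Real.exp_le_exp, neg_le_neg_iff]
            gcongr
    · have : E p = ∅ := Set.eq_empty_of_forall_notMem fun ω hω => hp hω.1
      rw [this, measureReal_empty]
      exact (Real.exp_pos _).le
  have hexp : Real.exp (-(B / r)) = ((n + 1 : ℝ) ^ (3 * N + d))⁻¹ := by
    rw [Real.exp_neg, hB, mul_assoc, mul_div_cancel_left₀ _ hr'.ne',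
      show (3 * (N : ℝ) + d) = ((3 * N + d : ℕ) : ℝ) by push_cast; ring, Real.exp_nat_mul,
      Real.exp_log (by positivity)]
  have hcard : (Fintype.card ((Fin n → Fin (n + 1)) × (Fin N → Fin (n + 1) × Fin n)) : ℝ) ≤
      (n + 1 : ℝ) ^ (3 * N) := by
    have : Fintype.card ((Fin n → Fin (n + 1)) × (Fin N → Fin (n + 1) × Fin n)) ≤
        (n + 1) ^ (3 * N) := by
      simp only [Fintype.card_prod, Fintype.card_fun, Fintype.card_fin]
      calc (n + 1) ^ n * ((n + 1) * n) ^ N ≤ (n + 1) ^ N * ((n + 1) * (n + 1)) ^ N := by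
            gcongr <;> omega
        _ = (n + 1) ^ (3 * N) := by rw [mul_pow]; ring
    exact_mod_cast this
  calc tapeMeasure.real (badEvent L r N B) ≤ tapeMeasure.real (⋃ p, E p) :=
        measureReal_mono fun ω ⟨c, f, h⟩ => Set.mem_iUnion.2 ⟨(c, f), h⟩
    _ ≤ ∑ p, tapeMeasure.real (E p) := measureReal_iUnion_fintype_le _
    _ ≤ ∑ _p : (Fin n → Fin (n + 1)) × (Fin N → Fin (n + 1) × Fin n), Real.exp (-(B / r)) :=
        Finset.sum_le_sum fun p _ => hE p
    _ ≤ (n + 1 : ℝ) ^ (3 * N) * ((n + 1 : ℝ) ^ (3 * N + d))⁻¹ := by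
        rw [Finset.sum_const, nsmul_eq_mul, Finset.card_univ, hexp]
        gcongr
    _ = 1 / (n + 1 : ℝ) ^ d := by
        rw [pow_add]
        field_simp
    _ ≤ 1 / (n : ℝ) ^ d := by
        gcongr
        linarith

/-- Lists with repetitions encode all nonempty sets of at most N elements, so counting functions
bounds the number of possible sets of ball entries. -/
theorem exists_range_eq_coe {α : Type*} (s : Finset α) (hs : s.Nonempty) {N : ℕ}
    (hN : s.card ≤ N) : ∃ f : Fin N → α, Set.range f = s := by
  obtain ⟨e⟩ : Nonempty (s ↪ Fin N) := Function.Embedding.nonempty_of_card_le (by simpa using hN)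
  have : Nonempty s := hs.to_subtype
  refine ⟨fun i => (Function.invFun e i : s), ?_⟩
  ext x
  constructor
  · rintro ⟨i, rfl⟩
    exact (Function.invFun e i).2
  · intro hx
    obtain ⟨i, hi⟩ := Function.invFun_surjective e.injective ⟨x, hx⟩
    exact ⟨i, by simp [hi]⟩

/-- The actual labels and entries are one of the cases of the union bound, and their uncovered pairs
avoid all samples; outside the bad event there must be fewer than `B` of them. -/
theorem uncovered_card_lt (hn : 1 ≤ n) (L : AdjList G) {k q r N : ℕ} {smp c : ℕ → ℕ}
    {P : ℕ → ℕ → ℕ} {ω : Tape} {B : ℝ}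
    (H : Grown G k q (sampleStart (GraphAccess.ofGraph G L) r) smp n c P)
    (hsmp : ∀ v < n, ∀ s, sampleStart (GraphAccess.ofGraph G L) r v ≤ s →
      s < sampleStart (GraphAccess.ofGraph G L) r (v + 1) →
      smp s = (GraphAccess.ofGraph G L).nbr v (ω.draw s ((GraphAccess.ofGraph G L).deg v)))
    (hN : q * n ≤ N) (hω : ω ∉ badEvent L r N B) : ((uncovered G c P).card : ℝ) < B := by
  classical
  let S : Finset (Fin (n + 1) × Fin n) := Finset.univ.filter fun p => P p.1 p.2 ≠ 0
  have hS : S.card ≤ N := by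
    have h₁ : S.card ≤ entries n P := by
      refine Finset.card_le_card_of_injOn (fun p => ((p.1 : ℕ), (p.2 : ℕ))) ?_ ?_
      · rintro ⟨l, w⟩ h
        have := l.2
        simp [S] at h ⊢
        exact ⟨by omega, h⟩
      · rintro ⟨l, w⟩ _ ⟨l', w'⟩ _ h
        simp only [Prod.mk.injEq] at h ⊢
        exact ⟨Fin.ext h.1, Fin.ext h.2⟩
    have h₂ : labelled n c ≤ n := (Finset.card_filter_le _ _).trans (Finset.card_range n).le
    exact ((h₁.trans H.count).trans (Nat.mul_le_mul_left q h₂)).trans hN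
  have hne : S.Nonempty := by
    have := H.forest.lab_le 0 hn
    refine ⟨(⟨c 0, by omega⟩, ⟨0, hn⟩), ?_⟩
    simpa [S] using H.forest.self 0 hn (H.done 0 hn)
  obtain ⟨f, hf⟩ := exists_range_eq_coe S hne hS
  let c' : Fin n → Fin (n + 1) := fun u => ⟨c u, Nat.lt_succ_of_le (H.forest.lab_le u u.2)⟩
  have heq : uncoveredBy G c' f = uncovered G c P := by
    ext ⟨u, w⟩
    simp [uncoveredBy, uncovered, hf, S, c']
  by_contra hB
  refine hω ⟨c', f, heq ▸ not_lt.1 hB, ?_⟩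
  rw [heq]
  intro u w huw s h₁ h₂
  rw [← hsmp u u.2 s h₁ h₂]
  exact H.sample_ne huw h₁ h₂

/-! ### Bounds -/

theorem sampleCount_le {L : AdjList G} {r : ℕ} (hr : 1 ≤ r) (v : ℕ) :
    sampleCount (GraphAccess.ofGraph G L) r v ≤ (GraphAccess.ofGraph G L).deg v := by
  rcases Nat.eq_zero_or_pos ((GraphAccess.ofGraph G L).deg v) with h | h
  · rw [sampleCount_eq_zero hr h]
    omega
  · rw [sampleCount]
    refine Nat.div_le_of_le_mul ?_
    obtain ⟨d, hd⟩ := Nat.exists_eq_succ_of_ne_zero h.ne'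
    obtain ⟨r', rfl⟩ := Nat.exists_eq_succ_of_ne_zero (show r ≠ 0 by omega)
    rw [hd]
    simp only [Nat.succ_eq_add_one, Nat.add_sub_cancel]
    nlinarith

theorem sampleStart_le_sq (hn : 1 ≤ n) (L : AdjList G) {r : ℕ} (hr : 1 ≤ r) :
    sampleStart (GraphAccess.ofGraph G L) r n ≤ n * n := by
  calc sampleStart (GraphAccess.ofGraph G L) r n ≤ ∑ _u ∈ Finset.range n, n :=
        Finset.sum_le_sum fun v _ =>
          (sampleCount_le hr v).trans ((GraphAccess.ofGraph_bdd hn L).deg v)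
    _ = n * n := by simp

theorem sum_deg (L : AdjList G) :
    ∑ v ∈ Finset.range n, (GraphAccess.ofGraph G L).deg v = 2 * G.edgeSet.ncard := by
  classical
  rw [Set.ncard_eq_toFinset_card', Finset.sum_range]
  rw [show G.edgeSet.toFinset = G.edgeFinset from rfl, ← G.sum_degrees_eq_twice_card_edges]
  refine Finset.sum_congr rfl fun v _ => ?_
  rw [GraphAccess.ofGraph_deg, ← List.toFinset_card_of_nodup (L.nodup v),
    ← G.card_neighborFinset_eq_degree]
  congr 1
  ext w
  simp [L.mem_iff]

/-- Rounding up costs one sample per node, and ρ ≤ 2⌊ρ⌋ costs a factor 2. If the minimum is n, then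
deg v / n ≤ 1, so a node takes at most two samples. -/
theorem sampleStart_le (hn : 1 ≤ n) (L : AdjList G) {ρ : ℝ} (hρ : 1 ≤ ρ) :
    (sampleStart (GraphAccess.ofGraph G L) (min ⌊ρ⌋₊ n) n : ℝ) ≤
      2 * n + 4 * (G.edgeSet.ncard / ρ) := by
  have hfl : 1 ≤ ⌊ρ⌋₊ := Nat.le_floor (by simpa using hρ)
  have hn' : (0 : ℝ) < n := by exact_mod_cast hn
  have hρ' : 0 < ρ := by linarith
  have key : ∀ v, (sampleCount (GraphAccess.ofGraph G L) (min ⌊ρ⌋₊ n) v : ℝ) ≤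
      2 + 2 * ((GraphAccess.ofGraph G L).deg v / ρ) := by
    intro v
    have hdn : ((GraphAccess.ofGraph G L).deg v : ℝ) ≤ n := by
      exact_mod_cast (GraphAccess.ofGraph_bdd hn L).deg v
    have hd0 : (0 : ℝ) ≤ (GraphAccess.ofGraph G L).deg v := Nat.cast_nonneg _
    have hr : 1 ≤ min ⌊ρ⌋₊ n := le_min hfl hn
    have hr' : (0 : ℝ) < (min ⌊ρ⌋₊ n : ℕ) := by exact_mod_cast hr
    have h₁ : (sampleCount (GraphAccess.ofGraph G L) (min ⌊ρ⌋₊ n) v : ℝ) ≤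
        (GraphAccess.ofGraph G L).deg v / (min ⌊ρ⌋₊ n : ℕ) + 1 := by
      rw [sampleCount]
      refine Nat.cast_div_le.trans ?_
      rw [div_add_one hr'.ne']
      gcongr
      rw [← Nat.cast_add, Nat.cast_le]
      omega
    rcases le_total ⌊ρ⌋₊ n with h | h
    · rw [min_eq_left h] at h₁ hr' ⊢
      have h₂ : ρ ≤ 2 * ⌊ρ⌋₊ := by
        have := Nat.lt_floor_add_one ρ
        have : (1 : ℝ) ≤ ⌊ρ⌋₊ := by exact_mod_cast hfl
        linarith
      have h₃ : ((GraphAccess.ofGraph G L).deg v : ℝ) / ⌊ρ⌋₊ ≤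
          2 * ((GraphAccess.ofGraph G L).deg v / ρ) := by
        rw [← mul_div_assoc, div_le_div_iff₀ hr' hρ']
        nlinarith
      linarith
    · rw [min_eq_right h] at h₁ ⊢
      have h₂ : ((GraphAccess.ofGraph G L).deg v : ℝ) / n ≤ 1 := (div_le_one hn').2 hdn
      have h₃ : 0 ≤ ((GraphAccess.ofGraph G L).deg v : ℝ) / ρ := by positivity
      linarith
  rw [sampleStart, Nat.cast_sum]
  calc ∑ v ∈ Finset.range n, (sampleCount (GraphAccess.ofGraph G L) (min ⌊ρ⌋₊ n) v : ℝ)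
      ≤ ∑ v ∈ Finset.range n, (2 + 2 * ((GraphAccess.ofGraph G L).deg v / ρ)) :=
        Finset.sum_le_sum fun v _ => key v
    _ = 2 * n + 2 * (((∑ v ∈ Finset.range n, (GraphAccess.ofGraph G L).deg v : ℕ) : ℝ) / ρ) := by
        rw [Finset.sum_add_distrib, ← Finset.mul_sum, ← Finset.sum_div]
        simp [mul_comm]
    _ = 2 * n + 4 * (G.edgeSet.ncard / ρ) := by
        rw [sum_deg]
        push_cast
        ring

theorem one_le_log_factor (hn : 1 ≤ n) : 1 ≤ 1 + Real.log n := by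
  have := Real.log_nonneg (show (1 : ℝ) ≤ n by exact_mod_cast hn)
  linarith

theorem le_polylog (hn : 1 ≤ n) {a : ℝ} {b C : ℕ} (ha : a ≤ C) (hb : b ≤ C) :
    a * (1 + Real.log n) ^ b ≤ polylog C n := by
  have h := one_le_log_factor hn
  unfold polylog
  gcongr

theorem size_le_log (hn : 1 ≤ n) : (n.size : ℝ) ≤ 2 * (1 + Real.log n) := by
  have hs : 1 ≤ n.size := Nat.size_pos.2 hn
  have h : 2 ^ (n.size - 1) ≤ n := Nat.lt_size.1 (by omega)
  have h' : ((2 : ℝ) ^ (n.size - 1)) ≤ n := by exact_mod_cast h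
  have h₁ := Real.log_le_log (by positivity) h'
  rw [Real.log_pow, Nat.cast_sub hs] at h₁
  have h₂ : (1 : ℝ) ≤ n.size := by exact_mod_cast hs
  have h₃ := Real.log_two_gt_d9
  push_cast at h₁
  nlinarith

theorem size_pow_le (a k : ℕ) : (a ^ k).size ≤ k * a.size + 1 := by
  induction k with
  | zero => simp
  | succ k ih =>
    have := size_mul_le (a ^ k) a
    rw [pow_succ, Nat.add_mul]
    omega

/-- The number n^k has about k log n digits; the polylogarithmic bound on k keeps each step
polylogarithmic. -/
theorem size_numBound_le (hn : 1 ≤ n) (L : AdjList G) {A k r : ℕ} (hr : 1 ≤ r)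
    (hk : (k : ℝ) ≤ polylog A n) :
    ((numBound (GraphAccess.ofGraph G L) n k r).size : ℝ) ≤
      (3 * A + 13) * (1 + Real.log n) ^ (A + 1) := by
  have hS := Nat.size_le_size (sampleStart_le_sq hn L hr)
  have hsq := size_mul_le n n
  have hself : k.size ≤ k := Nat.size_le.2 Nat.lt_two_pow_self
  have h₀ : (2 : ℕ).size = 2 := by decide
  have h₁ := size_pow_le n k
  have h : (numBound (GraphAccess.ofGraph G L) n k r).size ≤ k * n.size + k + 3 * n.size + 7 := by
    unfold numBound
    generalize sampleStart (GraphAccess.ofGraph G L) r n = S at *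
    have a₁ := size_add_le (n ^ k + k + n + S) 2
    have a₂ := size_add_le (n ^ k + k + n) S
    have a₃ := size_add_le (n ^ k + k) n
    have a₄ := size_add_le (n ^ k) k
    omega
  have h' : ((numBound (GraphAccess.ofGraph G L) n k r).size : ℝ) ≤
      k * n.size + k + 3 * n.size + 7 := by exact_mod_cast h
  have hl := one_le_log_factor hn
  have hs := size_le_log hn
  unfold polylog at hk
  obtain ⟨l, hl'⟩ : ∃ l, l = 1 + Real.log n := ⟨_, rfl⟩
  rw [← hl'] at hl hs hk ⊢
  have hlA : 1 ≤ l ^ A := one_le_pow₀ hl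
  have hk' : (k : ℝ) * n.size + k ≤ A * l ^ A * (3 * l) := by
    calc (k : ℝ) * n.size + k = k * (n.size + 1) := by ring
      _ ≤ A * l ^ A * (3 * l) := by
        gcongr
        linarith
  have hll : l ≤ l ^ A * l := le_mul_of_one_le_left (by linarith) hlA
  rw [pow_succ]
  nlinarith

/-- The least `q` with `n ≤ q ^ k` is at most twice the `k`-th root of `n`. -/
theorem root_le {k q : ℕ} (hn : 1 ≤ n) (hk : 1 ≤ k) (hq : (q - 1) ^ k < n) :
    (q : ℝ) ≤ 2 * (n : ℝ) ^ (1 / (k : ℝ)) := by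
  have hn' : (1 : ℝ) ≤ n := by exact_mod_cast hn
  have hx : 1 ≤ (n : ℝ) ^ (1 / (k : ℝ)) := Real.one_le_rpow hn' (by positivity)
  have hxk : ((n : ℝ) ^ (1 / (k : ℝ))) ^ k = n := by
    rw [one_div, Real.rpow_inv_natCast_pow (by positivity) (by omega)]
  have h : ((q - 1 : ℕ) : ℝ) < (n : ℝ) ^ (1 / (k : ℝ)) := by
    refine lt_of_pow_lt_pow_left₀ k (by positivity) ?_
    rw [hxk]
    exact_mod_cast hq
  have : (q : ℝ) ≤ (q - 1 : ℕ) + 1 := by exact_mod_cast (by omega : q ≤ q - 1 + 1)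
  linarith

theorem log_succ_le (hn : 1 ≤ n) : Real.log (n + 1) ≤ 1 + Real.log n := by
  have hn' : (1 : ℝ) ≤ n := by exact_mod_cast hn
  calc Real.log (n + 1) ≤ Real.log (2 * n) := Real.log_le_log (by positivity) (by linarith)
    _ = Real.log 2 + Real.log n := Real.log_mul (by norm_num) (by positivity)
    _ ≤ _ := by
      have := Real.log_two_lt_d9
      linarith

end RAM

/-! ### Assembling the theorem -/

open RAM in
theorem mainTheorem6 (c : ℕ) :
    ∃ pre query : RAM.Prog, ∀ A : ℕ, ∃ C : ℕ,
      ∀ (n : ℕ) (_hn : 1 ≤ n) (G : SimpleGraph (Fin n)) (L : AdjList G)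
        (k : ℕ) (_hk : 1 ≤ k) (_hkA : (k : ℝ) ≤ polylog A n) (ρ : ℝ) (_hρ : 1 ≤ ρ),
        (∀ ω : RAM.Tape, ∃ (t : ℕ) (τ : RAM.State),
          RAM.Exec (RAM.GraphAccess.ofGraph G L) ω pre
              (RAM.State.start [n, k, min ⌊ρ⌋₊ n] fun _ => 0) t τ ∧
            (t : ℝ) ≤ polylog C n * (n + (G.edgeSet.ncard : ℝ) / ρ)) ∧
        RAM.tapeMeasure.real {ω : RAM.Tape | ¬ ∃ (t : ℕ) (τ : RAM.State) (H : SimpleGraph (Fin n)),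
          RAM.Exec (RAM.GraphAccess.ofGraph G L) ω pre
              (RAM.State.start [n, k, min ⌊ρ⌋₊ n] fun _ => 0) t τ ∧
            RAM.IsAdjacencyOracle (RAM.GraphAccess.ofGraph G L) query τ.mem H (polylog C n) ∧
            IsSpanner G H (2 * k - 1) ∧
            (H.edgeSet.ncard : ℝ) ≤ polylog C n * (n : ℝ) ^ (1 + 1 / (k : ℝ)) * ρ ^ 2}
          ≤ 1 / (n : ℝ) ^ c := by
  obtain ⟨K, hK⟩ := preProg.code_spec
  obtain ⟨K', hK'⟩ := queryProg.code_spec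
  -- The summands serve the running time, the query time, the number of edges, and the exponent A +
  -- (A + 1) of the logarithm.
  refine ⟨preProg.code, queryProg.code, fun A => ⟨K * (3 * A + 100) * (3 * A + 13) +
    K' * (3 * A + 13) + (8 + c) + (2 * A + 1), fun n hn G L k hk hkA ρ hρ => ?_⟩⟩
  obtain ⟨C, hC⟩ : ∃ C, C = K * (3 * A + 100) * (3 * A + 13) + K' * (3 * A + 13) + (8 + c) +
    (2 * A + 1) := ⟨_, rfl⟩
  rw [← hC]
  have hfl : 1 ≤ ⌊ρ⌋₊ := Nat.le_floor (by simpa using hρ)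
  obtain ⟨r, hr⟩ : ∃ r, r = min ⌊ρ⌋₊ n := ⟨_, rfl⟩
  have hr₁ : 1 ≤ r := hr ▸ le_min hfl hn
  have hrn : r ≤ n := hr ▸ min_le_right _ _
  have hrρ : (r : ℝ) ≤ ρ :=
    (Nat.cast_le.2 (hr ▸ min_le_left _ _ : r ≤ ⌊ρ⌋₊)).trans (Nat.floor_le (by linarith))
  have hS := sampleStart_le hn L hρ
  rw [← hr] at hS ⊢
  obtain ⟨M, hM⟩ : ∃ M, M = numBound (GraphAccess.ofGraph G L) n k r := ⟨_, rfl⟩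
  have hM₁ : 1 ≤ M := by rw [hM, numBound]; omega
  have hnM : n ≤ M := by rw [hM, numBound]; omega
  have hgM : (GraphAccess.ofGraph G L).Bdd M := (GraphAccess.ofGraph_bdd hn L).mono hnM
  have hsize : (M.size : ℝ) ≤ (3 * A + 13) * (1 + Real.log n) ^ (A + 1) :=
    hM ▸ size_numBound_le hn L hr₁ hkA
  have hn' : (1 : ℝ) ≤ n := by exact_mod_cast hn
  have hl := one_le_log_factor hn
  have hρ' : 0 < ρ := by linarith
  have hm : 0 ≤ (G.edgeSet.ncard : ℝ) / ρ := by positivity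
  have hstart : (Env.start [n, k, r] fun _ _ _ => 0).Bdd M := by
    have hkM : k ≤ M := by rw [hM, numBound]; omega
    refine ⟨fun x => ?_, fun _ _ _ => Nat.zero_le _⟩
    simp only [Env.start]
    rcases x with ⟨_ | _ | _ | x, hx⟩ <;> simp <;> omega
  have run : ∀ ω, ∃ (t : ℕ) (τ : State) (ε' : Env) (q : ℕ) (smp : ℕ → ℕ),
      RAM.Exec (GraphAccess.ofGraph G L) ω preProg.code
        (State.start [n, k, r] fun _ => 0) t τ ∧
      (t : ℝ) ≤ polylog C n * (n + (G.edgeSet.ncard : ℝ) / ρ) ∧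
      Rep ε' τ ∧ ε'.Bdd M ∧ (q - 1) ^ k < n ∧
      Grown G k q (sampleStart (GraphAccess.ofGraph G L) r) smp n (ε'.arr 2 0) (ε'.arr 3) ∧
      ∀ v < n, ∀ s, sampleStart (GraphAccess.ofGraph G L) r v ≤ s →
        s < sampleStart (GraphAccess.ofGraph G L) r (v + 1) →
        smp s =
          (GraphAccess.ofGraph G L).nbr v (ω.draw s ((GraphAccess.ofGraph G L).deg v)) := by
    intro ω
    obtain ⟨N, ε', h₁, h₂, h₃, q, smp, h₄, h₅, h₆⟩ := preProg_exec hn L hk hr₁ hrn ω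
    rw [← hM] at h₁ h₃
    obtain ⟨t, τ, e, ht, hτ⟩ := hK _ ω M _ _ N _ h₁ hM₁ hgM hstart
      (Rep.start [n, k, r] (m := fun _ => 0) fun _ _ _ => rfl)
    refine ⟨t, τ, ε', q, smp, e, ?_, hτ, h₃, h₄, h₅, h₆⟩
    have hN : (N : ℝ) ≤ (3 * A + 100) * (1 + Real.log n) ^ A *
        (n + (G.edgeSet.ncard : ℝ) / ρ) := by
      have h : (N : ℝ) ≤ n * (3 * k + 33) +
          15 * sampleStart (GraphAccess.ofGraph G L) r n + 7 := by exact_mod_cast h₂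
      have hk' : (3 * (k : ℝ) + 100) ≤ (3 * A + 100) * (1 + Real.log n) ^ A := by
        unfold polylog at hkA
        have := one_le_pow₀ hl (n := A)
        nlinarith
      calc (N : ℝ) ≤ (3 * k + 100) * (n + (G.edgeSet.ncard : ℝ) / ρ) := by
            have : 0 ≤ (k : ℝ) * ((G.edgeSet.ncard : ℝ) / ρ) := by positivity
            nlinarith
        _ ≤ _ := by gcongr
    calc (t : ℝ) ≤ K * N * M.size := by exact_mod_cast ht
      _ ≤ K * ((3 * A + 100) * (1 + Real.log n) ^ A * (n + (G.edgeSet.ncard : ℝ) / ρ)) *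
          ((3 * A + 13) * (1 + Real.log n) ^ (A + 1)) := by gcongr
      _ = ((K * (3 * A + 100) * (3 * A + 13) : ℕ) : ℝ) * (1 + Real.log n) ^ (2 * A + 1) *
          (n + (G.edgeSet.ncard : ℝ) / ρ) := by
        push_cast
        ring
      _ ≤ _ := by
        gcongr
        refine le_polylog hn ?_ (by omega)
        rw [Nat.cast_le]
        omega
  refine ⟨fun ω => ?_, ?_⟩
  · obtain ⟨t, τ, -, -, -, e, ht, -⟩ := run ω
    exact ⟨t, τ, e, ht⟩
  obtain ⟨x, hx⟩ : ∃ x, x = (n : ℝ) ^ (1 / (k : ℝ)) := ⟨_, rfl⟩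
  have hx₁ : 1 ≤ x := hx ▸ Real.one_le_rpow hn' (by positivity)
  have hy : (n : ℝ) ^ (1 + 1 / (k : ℝ)) = n * x := by
    rw [hx, Real.rpow_add (by positivity), Real.rpow_one]
  -- A bound for q n fixed before the tape is chosen, as the union bound requires.
  obtain ⟨N, hN⟩ : ∃ N, N = n * ⌊2 * x⌋₊ := ⟨_, rfl⟩
  have hnN : n ≤ N := by
    rw [hN]
    exact Nat.le_mul_of_pos_right _ (Nat.le_floor (by push_cast; linarith))
  have hN' : (N : ℝ) ≤ 2 * (n * x) := by
    rw [hN]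
    push_cast
    nlinarith [Nat.floor_le (show 0 ≤ 2 * x by positivity)]
  -- Failure is contained in the bad event.
  refine (measureReal_mono fun ω hω => ?_).trans (badEvent_le hn L hr₁ hnN c)
  by_contra hbad
  refine hω ?_
  obtain ⟨t, τ, ε', q, smp, e, -, hτ, hε', hq, H, hsmp⟩ := run ω
  have hqN : q * n ≤ N := by
    rw [hN, mul_comm]
    exact Nat.mul_le_mul_left n (Nat.le_floor (hx ▸ root_le hn hk hq))
  have hU := uncovered_card_lt hn L H hsmp hqN hbad
  refine ⟨t, τ, spannerGraph G (ε'.arr 2 0) (ε'.arr 3), e, ⟨queryProg_isQuery, fun u v ω' => ?_⟩,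
    H.isSpanner hk, ?_⟩
  · obtain ⟨ε'', f₁, f₂⟩ := queryProg_exec L hM₁ ω' ε'.arr u v
    have hu := u.2
    have hv := v.2
    obtain ⟨t', τ', e', ht', hτ'⟩ := hK' _ ω' M _ _ 1 _ f₁ hM₁ hgM ⟨fun y => by
      simp only [Env.start]
      rcases y with ⟨_ | _ | y, hy⟩ <;> simp <;> omega, hε'.arr⟩ (Rep.start [u, v] hτ.mem)
    refine ⟨t', τ', e', ?_, ?_⟩
    · calc (t' : ℝ) ≤ K' * M.size := by exact_mod_cast (by simpa using ht')
        _ ≤ K' * ((3 * A + 13) * (1 + Real.log n) ^ (A + 1)) := by gcongr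
        _ = ((K' * (3 * A + 13) : ℕ) : ℝ) * (1 + Real.log n) ^ (A + 1) := by
          push_cast
          ring
        _ ≤ _ := by
          refine le_polylog hn ?_ (by omega)
          rw [Nat.cast_le]
          omega
    · rw [← f₂]
      exact hτ'.reg 0
  · have hE : ((spannerGraph G (ε'.arr 2 0) (ε'.arr 3)).edgeSet.ncard : ℝ) ≤
        N + (uncovered G (ε'.arr 2 0) (ε'.arr 3)).card := by
      exact_mod_cast H.ncard_edgeSet_le.trans (Nat.add_le_add_right hqN _)
    have hlog := log_succ_le hn
    have hlog₀ : 0 ≤ Real.log (n + 1) := Real.log_nonneg (by linarith)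
    have hnx : 1 ≤ n * x := by nlinarith
    rw [hy]
    calc ((spannerGraph G (ε'.arr 2 0) (ε'.arr 3)).edgeSet.ncard : ℝ)
        ≤ N + r * (3 * N + c) * Real.log (n + 1) := by linarith
      _ ≤ 2 * (n * x) + ρ * (3 * (2 * (n * x)) + c * (n * x)) * (1 + Real.log n) := by
        have : (c : ℝ) ≤ c * (n * x) := le_mul_of_one_le_right (Nat.cast_nonneg _) hnx
        gcongr
      _ = (2 + ρ * (6 + c) * (1 + Real.log n)) * (n * x) := by ring
      _ ≤ (((8 + c : ℕ) : ℝ) * (1 + Real.log n) ^ 1 * ρ ^ 2) * (n * x) := by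
        gcongr
        have h₁ : 1 ≤ ρ ^ 2 := one_le_pow₀ hρ
        -- The argument gives a bound linear in ρ; only here is it weakened to ρ².
        have h₂ : ρ ≤ ρ ^ 2 := by nlinarith
        have h₃ : 1 ≤ (1 + Real.log n) * ρ ^ 2 := by nlinarith
        have h₄ : ρ * ((6 + c) * (1 + Real.log n)) ≤ ρ ^ 2 * ((6 + c) * (1 + Real.log n)) := by
          gcongr
        push_cast
        nlinarith
      _ = ((8 + c : ℕ) : ℝ) * (1 + Real.log n) ^ 1 * (n * x) * ρ ^ 2 := by ring
      _ ≤ _ := by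
        gcongr
        refine le_polylog hn ?_ (by omega)
        rw [Nat.cast_le]
        omega
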